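/- Let $D>0$, $R>0$ and $a\in\mathbb{R}$, and let $\Phi\in L^\infty_{\mathrm{loc}}([0,\infty))$ be real-valued. Let $H^1(\mathbb{R})$ be the real Sobolev space with norm $\|f\|_{H^1}^2=\|f\|_{L^2}^2+\|f'\|_{L^2}^2$; its elements are identified with their continuous representatives. Consider the problem $$\partial_t u = D\,\partial_x^2 u+\Psi_t[u]\,\delta_0\quad (t>0,\ x\in\mathbb{R}),\qquad u(0,\cdot)=u_0,\qquad \Psi_t[u]:=\Phi(t)-a\,[\,u(t,-R)+u(t,R)\,].$$ For $s>0$ let $e^{s\Delta}$ be convolution with the heat kernel $\mathcal K_1(s,x)=(4\pi s)^{-1/2}e^{-x^2/(4s)}$, acting on functions in $H^1(\mathbb{R})$ and on the Dirac measure $\delta_0$, so that $e^{s\Delta}\delta_0=\mathcal K_1(s,\cdot)\in H^1(\mathbb{R})$, and let $e^{0\Delta}$ be the identity on $H^1(\mathbb{R})$. A mild solution with initial value $u_0\in H^1(\mathbb{R})$ is a continuous function $u:[0,\infty)\to H^1(\mathbb{R})$ such that for every $t\ge 0$ $$u(t)=e^{tD\Delta}u_0+\int_0^t \Psi_\tau[u]\,e^{(t-\tau)D\Delta}\delta_0\,\mathrm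 d\tau ,$$ where the integrand is Bochner integrable in $H^1(\mathbb{R})$. Then for every $u_0\in H^1(\mathbb{R})$ there is exactly one mild solution $u\in C^0([0,\infty),H^1(\mathbb{R}))$. Moreover, the solution map $u_0\mapsto u$ is continuous from $H^1(\mathbb{R})$ to $C^0([0,\infty),H^1(\mathbb{R}))$, where the latter carries the topology of uniform convergence on compact subsets of $[0,\infty)$. -/

import Mathlib

open MeasureTheory Set Filter Topology
open scoped ENNReal NNReal ContDiff

noncomputable section

namespace DiracSource

/-- `g` is the weak (distributional) derivative of `f` on the real line. -/
def IsWeakDeriv (f g : ℝ → ℝ) : Prop :=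
  ∀ φ : ℝ → ℝ, ContDiff ℝ ∞ φ → HasCompactSupport φ →
    ∫ x, f x * deriv φ x = - ∫ x, g x * φ x

theorem memLp_test {φ : ℝ → ℝ} (h1 : ContDiff ℝ ∞ φ) (h2 : HasCompactSupport φ) :
    MemLp φ 2 volume :=
  h1.continuous.memLp_of_hasCompactSupport h2

theorem memLp_deriv_test {φ : ℝ → ℝ} (h1 : ContDiff ℝ ∞ φ) (h2 : HasCompactSupport φ) :
    MemLp (deriv φ) 2 volume :=
  (h1.continuous_deriv (by simp)).memLp_of_hasCompactSupport h2.deriv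

theorem IsWeakDeriv.add {f g f' g' : ℝ → ℝ} (hf : MemLp f 2) (hg : MemLp g 2)
    (hf' : MemLp f' 2) (hg' : MemLp g' 2) (h : IsWeakDeriv f g) (h' : IsWeakDeriv f' g') :
    IsWeakDeriv (f + f') (g + g') := by
  intro φ h1 h2
  have hφ := memLp_test h1 h2
  have hdφ := memLp_deriv_test h1 h2
  simp only [Pi.add_apply, add_mul]
  have e1 : ∫ x, f x * deriv φ x + f' x * deriv φ x =
      (∫ x, f x * deriv φ x) + ∫ x, f' x * deriv φ x :=
    integral_add (hf.integrable_mul hdφ) (hf'.integrable_mul hdφ)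
  have e2 : ∫ x, g x * φ x + g' x * φ x = (∫ x, g x * φ x) + ∫ x, g' x * φ x :=
    integral_add (hg.integrable_mul hφ) (hg'.integrable_mul hφ)
  rw [e1, e2, h φ h1 h2, h' φ h1 h2]
  ring

theorem IsWeakDeriv.smul {f g : ℝ → ℝ} (c : ℝ) (h : IsWeakDeriv f g) :
    IsWeakDeriv (c • f) (c • g) := by
  intro φ h1 h2
  simp only [Pi.smul_apply, smul_eq_mul, mul_assoc, integral_const_mul]
  rw [h φ h1 h2]
  ring

theorem IsWeakDeriv.congr {f g f' g' : ℝ → ℝ} (h : IsWeakDeriv f g) (hf : f =ᵐ[volume] f')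
    (hg : g =ᵐ[volume] g') : IsWeakDeriv f' g' := by
  intro φ h1 h2
  have e1 : ∫ x, f' x * deriv φ x = ∫ x, f x * deriv φ x :=
    integral_congr_ae (by filter_upwards [hf] with x hx; rw [hx])
  have e2 : ∫ x, g' x * φ x = ∫ x, g x * φ x :=
    integral_congr_ae (by filter_upwards [hg] with x hx; rw [hx])
  rw [e1, e2, h φ h1 h2]

/-- The pairs `(f, f')` in `L² × L²` whose second entry is the weak derivative of the first. -/
def H1Submodule : Submodule ℝ (WithLp 2 (Lp ℝ 2 (volume : Measure ℝ) × Lp ℝ 2 (volume : Measure ℝ))) where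
  carrier := {p | IsWeakDeriv p.fst p.snd}
  add_mem' {p q} hp hq :=
    (IsWeakDeriv.add (Lp.memLp _) (Lp.memLp _) (Lp.memLp _) (Lp.memLp _) hp hq).congr
      (Lp.coeFn_add _ _).symm (Lp.coeFn_add _ _).symm
  zero_mem' := by
    have h : IsWeakDeriv 0 0 := fun φ _ _ => by simp
    exact h.congr (Lp.coeFn_zero _ _ _).symm (Lp.coeFn_zero _ _ _).symm
  smul_mem' c p hp :=
    (IsWeakDeriv.smul c hp).congr (Lp.coeFn_smul _ _).symm (Lp.coeFn_smul _ _).symm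

theorem continuous_integral_mul {ψ : ℝ → ℝ} (hψ : MemLp ψ 2 volume) :
    Continuous fun f : Lp ℝ 2 (volume : Measure ℝ) => ∫ x, f x * ψ x := by
  have h : Continuous fun f : Lp ℝ 2 (volume : Measure ℝ) => inner ℝ (hψ.toLp ψ) f := by
    fun_prop
  convert h using 2 with f
  rw [L2.inner_def]
  refine integral_congr_ae ?_
  filter_upwards [hψ.coeFn_toLp] with x hx
  rw [hx]
  simp

theorem isClosed_H1Submodule : IsClosed (H1Submodule : Set (WithLp 2
    (Lp ℝ 2 (volume : Measure ℝ) × Lp ℝ 2 (volume : Measure ℝ)))) := by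
  have : (H1Submodule : Set (WithLp 2
      (Lp ℝ 2 (volume : Measure ℝ) × Lp ℝ 2 (volume : Measure ℝ)))) =
      ⋂ (φ : ℝ → ℝ) (_ : ContDiff ℝ ∞ φ) (_ : HasCompactSupport φ),
        {p | ∫ x, p.fst x * deriv φ x = - ∫ x, p.snd x * φ x} := by
    ext p
    simp only [mem_iInter, mem_ofPred_eq]
    rfl
  rw [this]
  refine isClosed_iInter fun φ => isClosed_iInter fun h1 => isClosed_iInter fun h2 => ?_
  refine isClosed_eq ?_ ?_
  · exact (continuous_integral_mul (memLp_deriv_test h1 h2)).comp (by fun_prop)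
  · exact ((continuous_integral_mul (memLp_test h1 h2)).comp (by fun_prop)).neg

/-- The real Sobolev space `H¹(ℝ)`. An element is stored as the pair `(f, f')` of an `L²` function
and its weak derivative (which `f` determines), so the norm is the usual one,
`‖f‖² = ‖f‖²_{L²} + ‖f'‖²_{L²}`. -/
abbrev H1 : Type := H1Submodule

instance : CompleteSpace H1 := isClosed_H1Submodule.completeSpace_coe

/-- The element of `H¹(ℝ)` given by a square integrable function `f` with a square integrable weak
derivative `g`. -/
def H1.mk (f g : ℝ → ℝ) (hf : MemLp f 2 volume) (hg : MemLp g 2 volume)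
    (h : IsWeakDeriv f g) : H1 :=
  ⟨WithLp.toLp 2 (hf.toLp f, hg.toLp g),
    h.congr hf.coeFn_toLp.symm hg.coeFn_toLp.symm⟩

theorem integral_deriv_test {φ : ℝ → ℝ} (h1 : ContDiff ℝ ∞ φ) (h2 : HasCompactSupport φ) :
    ∫ x, deriv φ x = 0 :=
  integral_eq_zero_of_hasDerivAt_of_integrable
    (fun x => ((h1.differentiable (by simp)) x).hasDerivAt)
    ((h1.continuous_deriv (by simp)).integrable_of_hasCompactSupport h2.deriv)
    (h1.continuous.integrable_of_hasCompactSupport h2)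

theorem exists_primitive {ψ : ℝ → ℝ} (h1 : ContDiff ℝ ∞ ψ) (h2 : HasCompactSupport ψ)
    (h0 : ∫ x, ψ x = 0) :
    ∃ φ : ℝ → ℝ, ContDiff ℝ ∞ φ ∧ HasCompactSupport φ ∧ deriv φ = ψ := by
  obtain ⟨r, hr⟩ := h2.isCompact.isBounded.subset_closedBall 0
  have hout : ∀ x, r < |x| → ψ x = 0 := fun x hx => by
    by_contra hne
    have := hr (subset_tsupport ψ hne)
    simp at this
    linarith
  have hd : ∀ x, HasDerivAt (fun y => ∫ t in (-|r| - 1)..y, ψ t) (ψ x) x := fun x =>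
    intervalIntegral.integral_hasDerivAt_right (h1.continuous.intervalIntegrable _ _)
      (h1.continuous.stronglyMeasurableAtFilter _ _) h1.continuous.continuousAt
  have hderiv : deriv (fun y => ∫ t in (-|r| - 1)..y, ψ t) = ψ := funext fun x => (hd x).deriv
  refine ⟨_, ?_, ?_, hderiv⟩
  · rw [contDiff_infty_iff_deriv]
    exact ⟨fun x => (hd x).differentiableAt, by rw [hderiv]; exact h1⟩
  · refine HasCompactSupport.of_support_subset_isCompact
      (isCompact_Icc (a := -|r| - 1) (b := |r| + 1)) ?_
    intro y hy
    by_contra hny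
    apply hy
    have hi : Integrable ψ := h1.continuous.integrable_of_hasCompactSupport h2
    rw [mem_Icc, not_and_or, not_le, not_le] at hny
    rcases hny with hlt | hgt
    · refine intervalIntegral.integral_zero_ae (ae_of_all _ fun t ht => ?_)
      rw [uIoc_of_ge hlt.le] at ht
      apply hout
      have := le_abs_self r
      have := neg_abs_le t
      have : -|t| ≤ t := neg_abs_le t
      have : |t| = -t := abs_of_nonpos (by have := abs_nonneg r; linarith [ht.2])
      linarith [ht.2]
    · rw [← h0]
      refine intervalIntegral.integral_eq_integral_of_support_subset ?_
      intro t ht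
      have : |t| ≤ r := by
        by_contra hc
        exact ht (hout t (not_le.mp hc))
      have := abs_le.mp this
      have := le_abs_self r
      constructor <;> linarith

theorem exists_continuous_ae_eq {f g : ℝ → ℝ} (hf : MemLp f 2 volume) (hg : MemLp g 2 volume)
    (h : IsWeakDeriv f g) : ∃ c : ℝ → ℝ, Continuous c ∧ f =ᵐ[volume] c := by
  have hfl : LocallyIntegrable f := hf.locallyIntegrable (by norm_num)
  have hgl : LocallyIntegrable g := hg.locallyIntegrable (by norm_num)
  have hgi : ∀ a b : ℝ, IntervalIntegrable g volume a b := fun a b =>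
    (hgl.integrableOn_isCompact isCompact_uIcc).intervalIntegrable
  set G : ℝ → ℝ := fun x => ∫ t in (0 : ℝ)..x, g t with hG
  have hGc : Continuous G := intervalIntegral.continuous_primitive hgi 0
  have hGw : ∀ φ : ℝ → ℝ, ContDiff ℝ ∞ φ → HasCompactSupport φ →
      ∫ x, G x * deriv φ x = - ∫ x, g x * φ x := by
    intro φ h1 h2
    obtain ⟨r, hr⟩ := h2.isCompact.isBounded.subset_closedBall 0
    set s := |r| + 1 with hs
    have hin : ∀ x, x ∈ tsupport φ → x ∈ Ioo (-s) s := fun x hx => by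
      have := hr hx
      simp at this
      have h3 := abs_le.mp this
      have := le_abs_self r
      constructor <;> linarith
    have e1 : ∫ x, G x * deriv φ x = ∫ x in (-s)..s, G x * deriv φ x :=
      (intervalIntegral.integral_eq_integral_of_support_subset (fun x hx =>
        Ioo_subset_Ioc_self (hin x (support_deriv_subset (right_ne_zero_of_mul hx))))).symm
    have e2 : ∫ x, g x * φ x = ∫ x in (-s)..s, g x * φ x :=
      (intervalIntegral.integral_eq_integral_of_support_subset (fun x hx =>
        Ioo_subset_Ioc_self (hin x (subset_tsupport _ (right_ne_zero_of_mul hx))))).symm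
    have hz : ∀ x, x ∉ Ioo (-s) s → φ x = 0 := fun x hx =>
      image_eq_zero_of_notMem_tsupport fun hx' => hx (hin x hx')
    have hs0 : -s ≤ s := by have := abs_nonneg r; linarith
    have hGa : AbsolutelyContinuousOnInterval G (-s) s :=
      (hgi (-s) s).absolutelyContinuousOnInterval_intervalIntegral (c := 0) (by
        rw [uIcc_of_le hs0]; have := abs_nonneg r; constructor <;> linarith)
    have hφa : AbsolutelyContinuousOnInterval φ (-s) s :=
      ((h1.of_le (by simp)).contDiffOn).absolutelyContinuousOnInterval
    have key := hGa.integral_mul_deriv_eq_deriv_mul hφa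
    rw [hz s (by simp), hz (-s) (by simp)] at key
    rw [e1, e2, key]
    simp only [mul_zero, sub_self, zero_sub, neg_inj]
    refine intervalIntegral.integral_congr_ae ?_
    filter_upwards [LocallyIntegrable.ae_hasDerivAt_integral hgl] with x hx _
    rw [(hx 0).deriv]
  have hwl : LocallyIntegrable (fun x => f x - G x) := hfl.sub hGc.locallyIntegrable
  obtain ⟨η, hη1, hη2, hη3⟩ : ∃ η : ℝ → ℝ, ContDiff ℝ ∞ η ∧ HasCompactSupport η ∧
      ∫ x, η x = 1 := by
    let b : ContDiffBump (0 : ℝ) := default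
    exact ⟨b.normed volume, b.contDiff_normed, b.hasCompactSupport_normed, b.integral_normed⟩
  have hint : ∀ {w φ : ℝ → ℝ}, LocallyIntegrable w → Continuous φ → HasCompactSupport φ →
      Integrable (fun x => w x * φ x) := fun {w φ} hw h1 h2 => by
    have := hw.integrable_smul_left_of_hasCompactSupport h1 h2
    refine this.congr (ae_of_all _ fun x => ?_)
    simp [mul_comm]
  set C := ∫ x, (f x - G x) * η x with hC
  have hae : ∀ᵐ x, f x - G x = C := by
    refine ae_eq_of_integral_contDiff_smul_eq hwl (locallyIntegrable_const C) ?_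
    intro ψ h1 h2
    set m := ∫ x, ψ x with hm
    have hψi : Integrable ψ := h1.continuous.integrable_of_hasCompactSupport h2
    have hηi : Integrable η := hη1.continuous.integrable_of_hasCompactSupport hη2
    obtain ⟨φ, p1, p2, p3⟩ := exists_primitive (ψ := fun x => ψ x - m * η x)
      (h1.sub (contDiff_const.mul hη1)) (h2.sub hη2.mul_left)
      (by rw [integral_sub hψi (hηi.const_mul m), integral_const_mul, hη3]; simp [hm])
    have hdc : Continuous (deriv φ) := p1.continuous_deriv (by simp)
    have z : ∫ x, (f x - G x) * deriv φ x = 0 := by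
      simp only [sub_mul]
      rw [integral_sub (hint hfl hdc p2.deriv) (hint hGc.locallyIntegrable hdc p2.deriv),
        h φ p1 p2, hGw φ p1 p2]
      ring
    rw [p3] at z
    have z2 : ∫ x, (f x - G x) * (ψ x - m * η x) = (∫ x, (f x - G x) * ψ x) - m * C := by
      rw [hC, ← integral_const_mul, ← integral_sub (hint hwl h1.continuous h2)
        ((hint hwl hη1.continuous hη2).const_mul m)]
      congr 1; ext x; ring
    rw [z2] at z
    simp only [smul_eq_mul]
    rw [integral_mul_const, ← hm, ← sub_eq_zero.mp z]
    congr 1; ext x; ring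
  refine ⟨fun x => G x + C, hGc.add continuous_const, ?_⟩
  filter_upwards [hae] with x hx
  linarith

theorem H1.exists_rep (f : H1) :
    ∃ c : ℝ → ℝ, Continuous c ∧ (f.1.fst : ℝ → ℝ) =ᵐ[volume] c :=
  exists_continuous_ae_eq (Lp.memLp _) (Lp.memLp _) f.2

/-- The continuous representative of an element of `H¹(ℝ)`; `f.rep x` is the point evaluation. -/
def H1.rep (f : H1) : ℝ → ℝ := f.exists_rep.choose

theorem H1.continuous_rep (f : H1) : Continuous f.rep := f.exists_rep.choose_spec.1

theorem H1.ae_eq_rep (f : H1) : (f.1.fst : ℝ → ℝ) =ᵐ[volume] f.rep := f.exists_rep.choose_spec.2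


/-- The Gauss-Weierstrass kernel `exp (-x² / (4 s)) / √(4 π s)`, for `s > 0`. -/
def heatKernel (s x : ℝ) : ℝ := Real.exp (-(x ^ 2 / (4 * s))) / Real.sqrt (4 * Real.pi * s)

/-- Convolution of a function with the heat kernel at time `s`. -/
def heatConv (s : ℝ) (f : ℝ → ℝ) (x : ℝ) : ℝ := ∫ y, heatKernel s (x - y) * f y

/-- Convolution of a measure with the heat kernel at time `s`. -/
def heatConvMeasure (s : ℝ) (μ : Measure ℝ) (x : ℝ) : ℝ := ∫ y, heatKernel s (x - y) ∂μ

theorem heatKernel_nonneg (s x : ℝ) : 0 ≤ heatKernel s x := by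
  unfold heatKernel; positivity

theorem heatKernel_eq_gaussian {s : ℝ} (hs : 0 < s) :
    heatKernel s = ProbabilityTheory.gaussianPDFReal 0 (2 * s).toNNReal := by
  ext x
  rw [ProbabilityTheory.gaussianPDFReal_def, heatKernel]
  rw [Real.coe_toNNReal _ (by positivity), div_eq_mul_inv, mul_comm]
  congr 2
  · ring_nf
  · ring_nf

theorem continuous_heatKernel (s : ℝ) : Continuous (heatKernel s) := by
  unfold heatKernel; fun_prop

theorem integrable_heatKernel {s : ℝ} (hs : 0 < s) : Integrable (heatKernel s) := by
  rw [heatKernel_eq_gaussian hs]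
  exact ProbabilityTheory.integrable_gaussianPDFReal _ _

theorem lintegral_heatKernel {s : ℝ} (hs : 0 < s) :
    ∫⁻ x, ENNReal.ofReal (heatKernel s x) = 1 := by
  rw [heatKernel_eq_gaussian hs]
  exact ProbabilityTheory.lintegral_gaussianPDFReal_eq_one 0 (by
    simpa using hs)

theorem heatConv_eq (s : ℝ) (f : ℝ → ℝ) (x : ℝ) :
    heatConv s f x = ∫ y, heatKernel s y * f (x - y) := by
  rw [heatConv, ← integral_sub_left_eq_self (fun y => heatKernel s y * f (x - y)) volume x]
  simp

theorem sq_lintegral_le {f : ℝ → ℝ} (hf : StronglyMeasurable f) {s : ℝ} (hs : 0 < s) (x : ℝ) :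
    (∫⁻ y, ENNReal.ofReal (heatKernel s y) * ‖f (x - y)‖ₑ) ^ 2 ≤
      ∫⁻ y, ENNReal.ofReal (heatKernel s y) * ‖f (x - y)‖ₑ ^ 2 := by
  have hk : Measurable fun y => ENNReal.ofReal (heatKernel s y) :=
    (continuous_heatKernel s).measurable.ennreal_ofReal
  have hm : Measurable fun y => f (x - y) := hf.measurable.comp (by fun_prop)
  set ν := volume.withDensity fun y => ENNReal.ofReal (heatKernel s y)
  have : IsProbabilityMeasure ν := ⟨by
    rw [withDensity_apply _ MeasurableSet.univ, Measure.restrict_univ, lintegral_heatKernel hs]⟩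
  have h := eLpNorm_le_eLpNorm_of_exponent_le (μ := ν) (p := 1) (q := 2) (by norm_num)
    hm.aestronglyMeasurable
  have e2 := eLpNorm_nnreal_pow_eq_lintegral (μ := ν) (p := 2) (f := fun y => f (x - y))
    (by norm_num)
  norm_num at e2
  have h2 := pow_le_pow_left₀ (by positivity) h 2
  rw [e2, eLpNorm_one_eq_lintegral_enorm] at h2
  rw [lintegral_withDensity_eq_lintegral_mul _ hk (by fun_prop),
    lintegral_withDensity_eq_lintegral_mul _ hk (by fun_prop)] at h2
  exact h2

theorem lintegral_heat_sq {f : ℝ → ℝ} (hf : StronglyMeasurable f) {s : ℝ} (hs : 0 < s) :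
    ∫⁻ x, ∫⁻ y, ENNReal.ofReal (heatKernel s y) * ‖f (x - y)‖ₑ ^ 2 = ∫⁻ x, ‖f x‖ₑ ^ 2 := by
  have hk : Measurable fun y => ENNReal.ofReal (heatKernel s y) :=
    (continuous_heatKernel s).measurable.ennreal_ofReal
  have hfm := hf.measurable
  have hm2 : Measurable (Function.uncurry fun x y : ℝ =>
      ENNReal.ofReal (heatKernel s y) * ‖f (x - y)‖ₑ ^ 2) :=
    (hk.comp measurable_snd).mul
      ((hfm.comp (measurable_fst.sub measurable_snd)).enorm.pow_const 2)
  rw [lintegral_lintegral_swap hm2.aemeasurable]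
  have : ∀ y, ∫⁻ x, ENNReal.ofReal (heatKernel s y) * ‖f (x - y)‖ₑ ^ 2 =
      ENNReal.ofReal (heatKernel s y) * ∫⁻ x, ‖f x‖ₑ ^ 2 := fun y => by
    have hm : Measurable fun x => ‖f (x - y)‖ₑ ^ 2 :=
      (hfm.comp (measurable_id.sub_const y)).enorm.pow_const 2
    rw [lintegral_const_mul _ hm,
      lintegral_sub_right_eq_self (fun x => ‖f x‖ₑ ^ 2) y]
  simp_rw [this]
  rw [lintegral_mul_const _ hk, lintegral_heatKernel hs, one_mul]

theorem heatConv_congr {f f' : ℝ → ℝ} (h : f =ᵐ[volume] f') (s : ℝ) :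
    heatConv s f = heatConv s f' := by
  ext x
  exact integral_congr_ae (by filter_upwards [h] with y hy; rw [hy])

theorem stronglyMeasurable_heatConv {f : ℝ → ℝ} (hf : StronglyMeasurable f) (s : ℝ) :
    StronglyMeasurable (heatConv s f) := by
  have hfm := hf.measurable
  have hk := (continuous_heatKernel s).measurable
  have : StronglyMeasurable (Function.uncurry fun x y : ℝ => heatKernel s (x - y) * f y) := by
    apply Measurable.stronglyMeasurable
    simp only [Function.uncurry_def]
    fun_prop
  exact this.integral_prod_right

theorem memLp_heatConv {f : ℝ → ℝ} (hf : MemLp f 2 volume) {s : ℝ} (hs : 0 < s) :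
    MemLp (heatConv s f) 2 volume := by
  obtain ⟨f', hf', hff'⟩ := hf.1
  rw [heatConv_congr hff' s]
  have hL : MemLp f' 2 volume := (memLp_congr_ae hff').mp hf
  refine ⟨(stronglyMeasurable_heatConv hf' s).aestronglyMeasurable, ?_⟩
  have e2 := fun g : ℝ → ℝ => eLpNorm_nnreal_pow_eq_lintegral (μ := volume) (p := 2) (f := g)
    (by norm_num)
  norm_num at e2
  have hfin : eLpNorm (heatConv s f') 2 volume ^ 2 ≤ eLpNorm f' 2 volume ^ 2 := by
    rw [e2, e2, ← lintegral_heat_sq hf' hs]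
    refine lintegral_mono fun x => le_trans ?_ (sq_lintegral_le hf' hs x)
    refine pow_le_pow_left₀ (by positivity) ?_ 2
    rw [heatConv_eq]
    refine (enorm_integral_le_lintegral_enorm _).trans (lintegral_mono fun y => ?_)
    rw [enorm_mul, Real.enorm_of_nonneg (heatKernel_nonneg s y)]
  by_contra hc
  rw [not_lt, top_le_iff] at hc
  rw [hc] at hfin
  have := hL.2
  simp at hfin
  exact this.ne hfin

theorem integrable_heat_prod {f ψ : ℝ → ℝ} (hf : StronglyMeasurable f) (hf2 : MemLp f 2 volume)
    (hψ : Continuous ψ) (hψ2 : MemLp ψ 2 volume) {s : ℝ} (hs : 0 < s) :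
    Integrable (Function.uncurry fun x y => heatKernel s y * f (x - y) * ψ x)
      (volume.prod volume) := by
  have hfm := hf.measurable
  have hk := (continuous_heatKernel s).measurable
  have hψm := hψ.measurable
  have hm : Measurable (Function.uncurry fun x y => heatKernel s y * f (x - y) * ψ x) := by
    simp only [Function.uncurry_def]
    fun_prop
  refine ⟨hm.aestronglyMeasurable, ?_⟩
  rw [HasFiniteIntegral, lintegral_prod_symm' _ hm.enorm]
  simp only [Function.uncurry_apply_pair, enorm_mul]
  have hb : ∀ y, ∫⁻ x, ‖heatKernel s y‖ₑ * ‖f (x - y)‖ₑ * ‖ψ x‖ₑ ≤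
      ENNReal.ofReal (heatKernel s y) * (eLpNorm f 2 volume * eLpNorm ψ 2 volume) := by
    intro y
    simp only [mul_assoc]
    rw [lintegral_const_mul _ (by fun_prop), Real.enorm_of_nonneg (heatKernel_nonneg s y)]
    gcongr
    have h := eLpNorm_smul_le_mul_eLpNorm (p := 2) (q := 2) (r := 1) (μ := volume)
      hψ2.1 (f := ψ) (φ := fun x => f (x - y))
      (hfm.comp (measurable_id.sub_const y)).aestronglyMeasurable
    rw [eLpNorm_one_eq_lintegral_enorm] at h
    simp only [Pi.smul_apply', smul_eq_mul, enorm_mul] at h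
    have e : eLpNorm (fun x => f (x - y)) 2 volume = eLpNorm f 2 volume :=
      eLpNorm_comp_measurePreserving hf2.1 (measurePreserving_sub_right volume y)
    rwa [e] at h
  refine (lintegral_mono hb).trans_lt ?_
  rw [lintegral_mul_const _ hk.ennreal_ofReal, lintegral_heatKernel hs, one_mul]
  exact ENNReal.mul_lt_top hf2.2 hψ2.2

theorem integral_heatConv_mul {f ψ : ℝ → ℝ} (hf : StronglyMeasurable f) (hf2 : MemLp f 2 volume)
    (hψ : Continuous ψ) (hψ2 : MemLp ψ 2 volume) {s : ℝ} (hs : 0 < s) :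
    ∫ x, heatConv s f x * ψ x = ∫ y, heatKernel s y * ∫ x, f x * ψ (x + y) := by
  have e : ∀ x, heatConv s f x * ψ x = ∫ y, heatKernel s y * f (x - y) * ψ x := fun x => by
    rw [heatConv_eq, integral_mul_const]
  simp_rw [e]
  rw [integral_integral_swap (integrable_heat_prod hf hf2 hψ hψ2 hs)]
  congr 1; ext y
  simp only [mul_assoc]
  rw [integral_const_mul, ← integral_sub_right_eq_self (fun x => f x * ψ (x + y)) y]
  simp

theorem IsWeakDeriv.heatConv {f g : ℝ → ℝ} (hf : MemLp f 2 volume) (hg : MemLp g 2 volume)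
    (h : IsWeakDeriv f g) {s : ℝ} (hs : 0 < s) :
    IsWeakDeriv (heatConv s f) (heatConv s g) := by
  obtain ⟨f', hf', hff'⟩ := hf.1
  obtain ⟨g', hg', hgg'⟩ := hg.1
  rw [heatConv_congr hff' s, heatConv_congr hgg' s]
  replace h := h.congr hff' hgg'
  intro φ h1 h2
  rw [integral_heatConv_mul hf' ((memLp_congr_ae hff').mp hf) (h1.continuous_deriv (by simp))
    (memLp_deriv_test h1 h2) hs,
    integral_heatConv_mul hg' ((memLp_congr_ae hgg').mp hg) h1.continuous (memLp_test h1 h2) hs,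
    ← integral_neg]
  congr 1; ext y
  have := h (fun x => φ (x + y)) (h1.comp (contDiff_id.add contDiff_const))
    (h2.comp_homeomorph (Homeomorph.addRight y))
  simp only [deriv_comp_add_const] at this
  rw [this]
  ring

/-- The diffusion semigroup `e^{sΔ}` on `H¹(ℝ)`: convolution with the heat kernel for `s > 0`, and the
identity for `s = 0`. (The weak derivative of the convolution `K_s * f` is `K_s * f'`.) -/
def heatSemigroup (s : ℝ) (f : H1) : H1 :=
  if hs : 0 < s then
    H1.mk (heatConv s f.1.fst) (heatConv s f.1.snd) (memLp_heatConv (Lp.memLp _) hs)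
      (memLp_heatConv (Lp.memLp _) hs) (IsWeakDeriv.heatConv (Lp.memLp _) (Lp.memLp _) f.2 hs)
  else f

theorem heatConvMeasure_dirac (s : ℝ) : heatConvMeasure s (Measure.dirac 0) = heatKernel s := by
  ext x
  simp [heatConvMeasure]

theorem memLp_heatKernel {s : ℝ} (hs : 0 < s) : MemLp (heatKernel s) 2 volume := by
  rw [memLp_two_iff_integrable_sq (continuous_heatKernel s).aestronglyMeasurable]
  have := (integrable_exp_neg_mul_sq (b := 1 / (2 * s)) (by positivity)).const_mul
    ((Real.sqrt (4 * Real.pi * s))⁻¹ ^ 2)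
  refine this.congr (ae_of_all _ fun x => ?_)
  simp only [heatKernel, div_eq_mul_inv, mul_pow]
  rw [← Real.exp_nat_mul, mul_comm]
  congr 2
  field_simp
  ring

theorem hasDerivAt_heatKernel {s : ℝ} (hs : 0 < s) (x : ℝ) :
    HasDerivAt (heatKernel s) (-(x / (2 * s)) * heatKernel s x) x := by
  have h := ((((hasDerivAt_pow 2 x).div_const (4 * s)).neg).exp).div_const
    (Real.sqrt (4 * Real.pi * s))
  refine h.congr_deriv ?_
  simp only [heatKernel]
  field_simp
  simp
  ring

theorem memLp_deriv_heatKernel {s : ℝ} (hs : 0 < s) :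
    MemLp (fun x => -(x / (2 * s)) * heatKernel s x) 2 volume := by
  have hc : Continuous fun x => -(x / (2 * s)) * heatKernel s x :=
    (by fun_prop : Continuous fun x : ℝ => -(x / (2 * s))).mul (continuous_heatKernel s)
  rw [memLp_two_iff_integrable_sq hc.aestronglyMeasurable]
  have := (integrable_rpow_mul_exp_neg_mul_sq (b := 1 / (2 * s)) (s := 2) (by positivity)
    (by norm_num)).const_mul ((2 * s)⁻¹ ^ 2 * (Real.sqrt (4 * Real.pi * s))⁻¹ ^ 2)
  refine this.congr (ae_of_all _ fun x => ?_)
  simp only [heatKernel, div_eq_mul_inv, mul_pow, neg_sq]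
  rw [← Real.exp_nat_mul, Real.rpow_two]
  have : ((2 : ℕ) : ℝ) * -(x ^ 2 * (4 * s)⁻¹) = -(1 * (2 * s)⁻¹) * x ^ 2 := by
    push_cast; field_simp; ring
  rw [this]
  ring

theorem isWeakDeriv_heatKernel {s : ℝ} (hs : 0 < s) :
    IsWeakDeriv (heatKernel s) (fun x => -(x / (2 * s)) * heatKernel s x) := by
  intro φ h1 h2
  exact integral_mul_deriv_eq_deriv_mul_of_integrable
    (fun x _ => hasDerivAt_heatKernel hs x)
    (fun x _ => ((h1.differentiable (by simp)) x).hasDerivAt)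
    ((memLp_heatKernel hs).integrable_mul (memLp_deriv_test h1 h2))
    ((memLp_deriv_heatKernel hs).integrable_mul (memLp_test h1 h2))
    ((memLp_heatKernel hs).integrable_mul (memLp_test h1 h2))

/-- `e^{sΔ} δ₀`, the diffusion semigroup applied to the Dirac measure at `0`, as an element of `H¹(ℝ)`
for `s > 0`. For `s ≤ 0` it is not in `H¹(ℝ)`, and the value `0` is a placeholder. -/
def heatDirac (s : ℝ) : H1 :=
  if hs : 0 < s then
    H1.mk (heatConvMeasure s (Measure.dirac 0)) (fun x => -(x / (2 * s)) * heatKernel s x)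
      (by rw [heatConvMeasure_dirac]; exact memLp_heatKernel hs)
      (memLp_deriv_heatKernel hs)
      (by rw [heatConvMeasure_dirac]; exact isWeakDeriv_heatKernel hs)
  else 0

/-- `Φ ∈ L^∞_loc([0, ∞))`: measurable and essentially bounded on every compact subset of `[0, ∞)`. -/
def MemLinftyLoc (Φ : ℝ → ℝ) : Prop :=
  ∀ K : Set ℝ, IsCompact K → K ⊆ Ici 0 → MemLp Φ ∞ (volume.restrict K)

/-- The intensity `Ψ_t[u] = Φ(t) - a (u(t, -R) + u(t, R))` of the Dirac source, for `t ≥ 0`. -/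
def sourceIntensity (R a : ℝ) (Φ : ℝ → ℝ) (u : ℝ≥0 → H1) (t : ℝ) : ℝ :=
  Φ t - a * ((u t.toNNReal).rep (-R) + (u t.toNNReal).rep R)

/-- `u : [0, ∞) → H¹(ℝ)` solves the variation of constants formula of
`∂_t u = D ∂_x² u + Ψ_t[u] δ₀`, `u(0) = u₀`, that is
`u(t) = e^{tDΔ} u₀ + ∫₀ᵗ e^{(t-τ)DΔ} (Ψ_τ[u] δ₀) dτ` for all `t ≥ 0`, where the integral is a Bochner
integral in `H¹(ℝ)`. On `[0, t]` the placeholder value of `heatDirac` is met at `τ = t` only, a null set.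
Continuity of `u` is not part of this predicate. -/
structure IsMildSolution (D R a : ℝ) (Φ : ℝ → ℝ) (u₀ : H1) (u : ℝ≥0 → H1) : Prop where
  integrable : ∀ t : ℝ≥0, IntervalIntegrable
    (fun τ => sourceIntensity R a Φ u τ • heatDirac (D * (t - τ))) volume 0 t
  formula : ∀ t : ℝ≥0, u t = heatSemigroup (D * t) u₀ +
    ∫ τ in (0 : ℝ)..t, sourceIntensity R a Φ u τ • heatDirac (D * (t - τ))

end DiracSource

end

/-! Since `Ψ` is affine in `u`, the mild formulation is a linear Volterra equation `u = G + V u` in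
`C([0, ∞), H¹)`. Here `G(t)` is `e^{tDΔ} u₀` plus the convolution of `Φ` with `k(s) = e^{sDΔ} δ₀`,
and `V u(t) = ∫₀ᵗ L(u(τ)) k(t - τ) dτ` with `L f = -a (f(-R) + f(R))`.

Three facts carry the proof. Point evaluation is bounded on `H¹`, so `L` is a bounded functional
(`H1.exists_evalL`). The heat semigroup is a strongly continuous contraction on `H¹`
(`continuousOn_heatSemigroup`, `norm_heatSemigroup_le`). Finally, `‖k(s)‖` is at most a constant
times `s^(-1/4) + s^(-3/4)` (`norm_heatDirac_le`), a singularity integrable at `0`, so `∫ e^{-rs}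
‖k(s)‖ ds` tends to `0` as `r → ∞`.

For large `r` the operator `V` therefore halves every bound of the form `‖u(t)‖ ≤ A e^{rt}` on `[0,
T]`, with the same `r` for all `T` (`exists_norm_volterra_le`), so no gluing of local solutions is
needed. The Neumann series `∑ Vⁿ G` converges locally uniformly and gives existence. The same
estimate bounds the difference of two solutions by `2 ‖u₀ - v₀‖ e^{rt}`, which gives both uniqueness
and continuous dependence. -/

noncomputable section

namespace DiracSource

/-! ### Components and point evaluations on `H¹(ℝ)` -/

/-- The inclusion `H¹ → L²` as a continuous linear map. -/
def H1.fstL : H1 →L[ℝ] Lp ℝ 2 (volume : Measure ℝ) :=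
  (ContinuousLinearMap.fst ℝ _ _).comp
    ((WithLp.prodContinuousLinearEquiv 2 ℝ (Lp ℝ 2 (volume : Measure ℝ))
      (Lp ℝ 2 (volume : Measure ℝ))).toContinuousLinearMap.comp H1Submodule.subtypeL)

/-- The weak derivative `H¹ → L²` as a continuous linear map. -/
def H1.sndL : H1 →L[ℝ] Lp ℝ 2 (volume : Measure ℝ) :=
  (ContinuousLinearMap.snd ℝ _ _).comp
    ((WithLp.prodContinuousLinearEquiv 2 ℝ (Lp ℝ 2 (volume : Measure ℝ))
      (Lp ℝ 2 (volume : Measure ℝ))).toContinuousLinearMap.comp H1Submodule.subtypeL)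

theorem H1.fstL_apply (f : H1) : H1.fstL f = f.1.fst := rfl

theorem H1.ext_components {f g : H1} (h₁ : f.1.fst = g.1.fst) (h₂ : f.1.snd = g.1.snd) :
    f = g :=
  Subtype.ext (WithLp.ofLp_injective 2 (Prod.ext h₁ h₂))

theorem H1.norm_sq (f : H1) : ‖f‖ ^ 2 = ‖f.1.fst‖ ^ 2 + ‖f.1.snd‖ ^ 2 :=
  WithLp.prod_norm_sq_eq_of_L2 f.1

theorem H1.continuousOn_iff {X : Type*} [TopologicalSpace X] {s : Set X} {u : X → H1} :
    ContinuousOn u s ↔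
      ContinuousOn (fun x => (u x).1.fst) s ∧ ContinuousOn (fun x => (u x).1.snd) s := by
  refine ⟨fun h => ⟨H1.fstL.continuous.comp_continuousOn h,
    H1.sndL.continuous.comp_continuousOn h⟩, fun h => ?_⟩
  rw [Topology.IsInducing.subtypeVal.continuousOn_iff]
  exact (WithLp.prod_continuous_toLp 2 _ _).comp_continuousOn (h.1.prodMk h.2)

/-- Integration of an element of `H¹` against a square integrable function. -/
def H1.pairing {ψ : ℝ → ℝ} (hψ : MemLp ψ 2 volume) : H1 →L[ℝ] ℝ :=
  (innerSL ℝ (hψ.toLp ψ)).comp H1.fstL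

theorem H1.pairing_apply {ψ : ℝ → ℝ} (hψ : MemLp ψ 2 volume) (f : H1) :
    H1.pairing hψ f = ∫ x, f.rep x * ψ x := by
  simp only [H1.pairing, ContinuousLinearMap.comp_apply, innerSL_apply_apply, H1.fstL_apply]
  rw [L2.inner_def]
  refine integral_congr_ae ?_
  filter_upwards [hψ.coeFn_toLp, f.ae_eq_rep] with x hx hx'
  rw [hx, hx']
  simp

/-- Normalized bumps shrinking to `x` recover the value of a continuous function and lie in `L²`.
Evaluation on `H¹` becomes a pointwise limit of `L²` pairings, and Banach–Steinhaus then bounds it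
without an explicit Sobolev inequality. -/
theorem exists_tendsto_integral_mul (x : ℝ) : ∃ ψ : ℕ → ℝ → ℝ,
    (∀ n, MemLp (ψ n) 2 volume) ∧ ∀ c : ℝ → ℝ, Continuous c →
      Tendsto (fun n => ∫ y, c y * ψ n y) atTop (𝓝 (c x)) := by
  let φ : ℕ → ContDiffBump (0 : ℝ) := fun n =>
    ⟨1 / (n + 1) / 2, 1 / (n + 1), by positivity, half_lt_self (by positivity)⟩
  refine ⟨fun n y => (φ n).normed volume (x - y), fun n => ?_, fun c hc => ?_⟩
  · have h : MemLp ((φ n).normed volume) 2 volume :=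
      memLp_test (φ n).contDiff_normed (φ n).hasCompactSupport_normed
    exact h.comp_measurePreserving (Measure.measurePreserving_sub_left volume x)
  · have h := ContDiffBump.convolution_tendsto_right_of_continuous (φ := φ) (l := atTop)
      (μ := (volume : Measure ℝ)) tendsto_one_div_add_atTop_nhds_zero_nat hc x
    refine h.congr fun n => ?_
    rw [convolution_def,
      ← integral_sub_left_eq_self (fun y => c y * (φ n).normed volume (x - y)) volume x]
    refine integral_congr_ae (ae_of_all _ fun t => ?_)
    simp [mul_comm]

theorem exists_continuousLinearMap_of_tendsto {E : Type*} [NormedAddCommGroup E]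
    [NormedSpace ℝ E] [CompleteSpace E] (g : ℕ → E →L[ℝ] ℝ) (l : E → ℝ)
    (h : ∀ f, Tendsto (fun n => g n f) atTop (𝓝 (l f))) : ∃ L : E →L[ℝ] ℝ, ∀ f, L f = l f :=
  ⟨continuousLinearMapOfTendsto g (l := atTop) (tendsto_pi_nhds.mpr h), fun _ => rfl⟩

theorem H1.exists_evalL (x : ℝ) : ∃ L : H1 →L[ℝ] ℝ, ∀ f, L f = f.rep x := by
  obtain ⟨ψ, hψ, hlim⟩ := exists_tendsto_integral_mul x
  refine exists_continuousLinearMap_of_tendsto (fun n => H1.pairing (hψ n)) _ fun f => ?_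
  simp only [H1.pairing_apply]
  exact hlim _ f.continuous_rep

/-- Evaluation at `x` as a continuous linear functional on `H¹(ℝ)`. -/
def H1.evalL (x : ℝ) : H1 →L[ℝ] ℝ := (H1.exists_evalL x).choose

theorem H1.evalL_apply (x : ℝ) (f : H1) : H1.evalL x f = f.rep x :=
  (H1.exists_evalL x).choose_spec f

/-! ### The diffusion semigroup -/

/-- The average of the translates of `f ∈ L²` against the Gaussian of variance `2 s`. -/
def gaussianAverage (s : ℝ) (f : Lp ℝ 2 (volume : Measure ℝ)) : Lp ℝ 2 (volume : Measure ℝ) :=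
  ∫ z, heatKernel 1 z • (DomAddAct.mk (-(√s * z)) +ᵥ f)

theorem continuous_translate {p : ℝ≥0∞} [Fact (1 ≤ p)] [Fact (p ≠ (⊤ : ℝ≥0∞))] {E : Type*}
    [NormedAddCommGroup E] {X : Type*} [TopologicalSpace X] {c : X → ℝ} (hc : Continuous c)
    (f : Lp E p (volume : Measure ℝ)) :
    Continuous fun z : X => DomAddAct.mk (c z) +ᵥ f :=
  (DomAddAct.continuous_mk.comp hc).vadd continuous_const

instance : Fact ((2 : ℝ≥0∞) ≠ ⊤) := ⟨by norm_num⟩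

theorem integral_heatKernel_one : ∫ x, heatKernel 1 x = 1 := by
  rw [heatKernel_eq_gaussian one_pos]
  exact ProbabilityTheory.integral_gaussianPDFReal_eq_one 0 (by simp)

theorem integrable_gaussianAverage (s : ℝ) (f : Lp ℝ 2 (volume : Measure ℝ)) :
    Integrable fun z => heatKernel 1 z • (DomAddAct.mk (-(√s * z)) +ᵥ f) := by
  have hc : Continuous fun z => DomAddAct.mk (-(√s * z)) +ᵥ f :=
    continuous_translate (by fun_prop) f
  refine ((integrable_heatKernel one_pos).mul_const ‖f‖).mono'
    ((continuous_heatKernel 1).smul hc).aestronglyMeasurable (ae_of_all _ fun z => ?_)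
  rw [norm_smul, DomAddAct.norm_vadd_Lp, Real.norm_of_nonneg (heatKernel_nonneg 1 z)]

/-- After rescaling, `s` enters only through the translation by `√s * z`, while the Gaussian weight
is fixed. Translation is continuous in `L²`, and the dominating function does not depend on `s`, so
`s = 0` needs no separate argument. -/
theorem continuous_gaussianAverage (f : Lp ℝ 2 (volume : Measure ℝ)) :
    Continuous fun s => gaussianAverage s f := by
  refine continuous_of_dominated (bound := fun z => heatKernel 1 z * ‖f‖)
    (fun s => (integrable_gaussianAverage s f).aestronglyMeasurable)
    (fun s => ae_of_all _ fun z => ?_) ((integrable_heatKernel one_pos).mul_const _)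
    (ae_of_all _ fun z => ?_)
  · rw [norm_smul, DomAddAct.norm_vadd_Lp, Real.norm_of_nonneg (heatKernel_nonneg 1 z)]
  · have hc : Continuous fun s => DomAddAct.mk (-(√s * z)) +ᵥ f :=
      continuous_translate (by fun_prop) f
    exact hc.const_smul (heatKernel 1 z)

theorem gaussianAverage_zero (f : Lp ℝ 2 (volume : Measure ℝ)) : gaussianAverage 0 f = f := by
  simp [gaussianAverage, integral_smul_const, integral_heatKernel_one]

theorem norm_gaussianAverage_le (s : ℝ) (f : Lp ℝ 2 (volume : Measure ℝ)) :
    ‖gaussianAverage s f‖ ≤ ‖f‖ := by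
  refine (norm_integral_le_integral_norm _).trans_eq ?_
  simp_rw [norm_smul, DomAddAct.norm_vadd_Lp, Real.norm_of_nonneg (heatKernel_nonneg 1 _)]
  rw [integral_mul_const, integral_heatKernel_one, one_mul]

theorem gaussianAverage_sub (s : ℝ) (f g : Lp ℝ 2 (volume : Measure ℝ)) :
    gaussianAverage s (f - g) = gaussianAverage s f - gaussianAverage s g := by
  simp only [gaussianAverage]
  rw [← integral_sub (integrable_gaussianAverage s f) (integrable_gaussianAverage s g)]
  simp only [DomAddAct.vadd_Lp_sub, smul_sub]

theorem heatKernel_sqrt_mul {s : ℝ} (hs : 0 < s) (z : ℝ) :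
    √s * heatKernel s (√s * z) = heatKernel 1 z := by
  have h : √(4 * Real.pi * s) = √(4 * Real.pi) * √s := Real.sqrt_mul (by positivity) s
  have hs' : √s ≠ 0 := (Real.sqrt_pos.mpr hs).ne'
  simp only [heatKernel, mul_pow, Real.sq_sqrt hs.le, h]
  have e : s * z ^ 2 / (4 * s) = z ^ 2 / (4 * 1) := by field_simp
  rw [e, mul_one]
  field_simp

theorem integral_translate_mul (f : Lp ℝ 2 (volume : Measure ℝ)) (ψ : ℝ → ℝ) (c : ℝ) :
    ∫ x, (DomAddAct.mk (-c) +ᵥ f : Lp ℝ 2 (volume : Measure ℝ)) x * ψ x =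
      ∫ x, f x * ψ (x + c) := by
  rw [← integral_sub_right_eq_self (fun x => f x * ψ (x + c)) c]
  refine integral_congr_ae ?_
  filter_upwards [DomAddAct.vadd_Lp_ae_eq (DomAddAct.mk (-c)) f] with x hx
  rw [hx]
  simp [sub_eq_neg_add]

/-- The pairing with `ψ` is a bounded functional and passes under the Bochner integral; the
substitution `y = √s * z` restores the kernel at time `s`. This matches `integral_heatConv_mul`,
whence the convolution and the average agree almost everywhere. -/
theorem integral_gaussianAverage_mul {s : ℝ} (hs : 0 < s) (f : Lp ℝ 2 (volume : Measure ℝ))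
    {ψ : ℝ → ℝ} (hψ : MemLp ψ 2 volume) :
    ∫ x, gaussianAverage s f x * ψ x = ∫ y, heatKernel s y * ∫ x, f x * ψ (x + y) := by
  have hin : ∀ g : Lp ℝ 2 (volume : Measure ℝ), ∫ x, g x * ψ x = innerSL ℝ (hψ.toLp ψ) g := by
    intro g
    rw [innerSL_apply_apply, L2.inner_def]
    refine integral_congr_ae ?_
    filter_upwards [hψ.coeFn_toLp] with x hx
    rw [hx]
    simp
  rw [hin, gaussianAverage,
    ← ContinuousLinearMap.integral_comp_comm _ (integrable_gaussianAverage s f)]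
  simp_rw [map_smul, ← hin, integral_translate_mul, smul_eq_mul]
  have h := Measure.integral_comp_mul_left
    (fun y => heatKernel s y * ∫ x, f x * ψ (x + y)) (√s)
  have hs' : 0 < √s := Real.sqrt_pos.mpr hs
  rw [abs_of_pos (inv_pos.mpr hs'), smul_eq_mul] at h
  have h2 : (∫ y, heatKernel s y * ∫ x, f x * ψ (x + y)) =
      √s * ∫ z, heatKernel s (√s * z) * ∫ x, f x * ψ (x + √s * z) := by
    rw [h]; field_simp
  rw [h2, ← integral_const_mul]
  refine integral_congr_ae (ae_of_all _ fun z => ?_)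
  simp only [← heatKernel_sqrt_mul hs z]
  ring

theorem heatConv_ae_eq_gaussianAverage {s : ℝ} (hs : 0 < s) (f : Lp ℝ 2 (volume : Measure ℝ)) :
    heatConv s f =ᵐ[volume] gaussianAverage s f := by
  have hf := Lp.memLp f
  refine ae_eq_of_integral_contDiff_smul_eq
    ((memLp_heatConv hf hs).locallyIntegrable (by norm_num))
    ((Lp.memLp _).locallyIntegrable (by norm_num)) fun ψ h1 h2 => ?_
  simp only [smul_eq_mul, mul_comm (ψ _)]
  rw [integral_heatConv_mul (Lp.stronglyMeasurable f) hf h1.continuous (memLp_test h1 h2) hs,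
    integral_gaussianAverage_mul hs f (memLp_test h1 h2)]

theorem heatSemigroup_fst {s : ℝ} (hs : 0 ≤ s) (f : H1) :
    (heatSemigroup s f).1.fst = gaussianAverage s f.1.fst := by
  rcases hs.eq_or_lt with rfl | hs
  · simp [heatSemigroup, gaussianAverage_zero]
  · simp only [heatSemigroup, hs, dif_pos]
    refine Lp.ext (EventuallyEq.trans (MemLp.coeFn_toLp
      (memLp_heatConv (Lp.memLp _) hs)) (heatConv_ae_eq_gaussianAverage hs _))

theorem heatSemigroup_snd {s : ℝ} (hs : 0 ≤ s) (f : H1) :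
    (heatSemigroup s f).1.snd = gaussianAverage s f.1.snd := by
  rcases hs.eq_or_lt with rfl | hs
  · simp [heatSemigroup, gaussianAverage_zero]
  · simp only [heatSemigroup, hs, dif_pos]
    refine Lp.ext (EventuallyEq.trans (MemLp.coeFn_toLp
      (memLp_heatConv (Lp.memLp _) hs)) (heatConv_ae_eq_gaussianAverage hs _))

theorem continuousOn_heatSemigroup (f : H1) :
    ContinuousOn (fun s => heatSemigroup s f) (Ici 0) :=
  H1.continuousOn_iff.mpr
    ⟨(continuous_gaussianAverage _).continuousOn.congr fun _ hs => heatSemigroup_fst hs f,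
      (continuous_gaussianAverage _).continuousOn.congr fun _ hs => heatSemigroup_snd hs f⟩

theorem heatSemigroup_sub {s : ℝ} (hs : 0 ≤ s) (f g : H1) :
    heatSemigroup s (f - g) = heatSemigroup s f - heatSemigroup s g := by
  refine H1.ext_components ?_ ?_
  · change _ = (heatSemigroup s f).1.fst - (heatSemigroup s g).1.fst
    simp only [heatSemigroup_fst hs]
    exact gaussianAverage_sub s _ _
  · change _ = (heatSemigroup s f).1.snd - (heatSemigroup s g).1.snd
    simp only [heatSemigroup_snd hs]
    exact gaussianAverage_sub s _ _

theorem norm_heatSemigroup_le {s : ℝ} (hs : 0 ≤ s) (f : H1) : ‖heatSemigroup s f‖ ≤ ‖f‖ := by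
  refine le_of_sq_le_sq ?_ (norm_nonneg _)
  rw [H1.norm_sq, H1.norm_sq f, heatSemigroup_fst hs, heatSemigroup_snd hs]
  gcongr <;> exact norm_gaussianAverage_le _ _

/-! ### The heat kernel as an element of `H¹(ℝ)` -/

theorem norm_sq_eq_integral {f : ℝ → ℝ} {F : Lp ℝ 2 (volume : Measure ℝ)}
    (h : F =ᵐ[volume] f) : ‖F‖ ^ 2 = ∫ x, f x ^ 2 := by
  rw [← real_inner_self_eq_norm_sq, L2.inner_def]
  refine integral_congr_ae ?_
  filter_upwards [h] with x hx
  rw [hx]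
  simp [sq]

theorem integrable_exp_neg_sq_div {s : ℝ} (hs : 0 < s) :
    Integrable fun x : ℝ => Real.exp (-(x ^ 2 / (4 * s))) := by
  refine (integrable_exp_neg_mul_sq (b := 1 / (4 * s)) (by positivity)).congr
    (ae_of_all _ fun x => ?_)
  simp only
  congr 1
  ring

theorem integral_exp_neg_sq_div_le {s : ℝ} (hs : 0 < s) :
    ∫ x : ℝ, Real.exp (-(x ^ 2 / (4 * s))) ≤ 4 * √s := by
  have h := integral_gaussian (1 / (4 * s))
  have e : ∀ x : ℝ, Real.exp (-(1 / (4 * s)) * x ^ 2) = Real.exp (-(x ^ 2 / (4 * s))) :=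
    fun x => by congr 1; ring
  simp_rw [e] at h
  rw [h]
  refine Real.sqrt_le_iff.mpr ⟨by positivity, ?_⟩
  rw [mul_pow, Real.sq_sqrt hs.le]
  have : Real.pi / (1 / (4 * s)) = 4 * Real.pi * s := by field_simp
  rw [this]
  nlinarith [Real.pi_lt_four]

theorem sq_heatKernel_le {s : ℝ} (hs : 0 < s) (x : ℝ) :
    heatKernel s x ^ 2 ≤ s⁻¹ * Real.exp (-(x ^ 2 / (4 * s))) := by
  have he : Real.exp (-(x ^ 2 / (4 * s))) ≤ 1 := Real.exp_le_one_iff.mpr (by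
    have : 0 ≤ x ^ 2 / (4 * s) := by positivity
    linarith)
  have he0 := Real.exp_pos (-(x ^ 2 / (4 * s)))
  rw [heatKernel, div_pow, Real.sq_sqrt (by positivity), inv_mul_eq_div]
  gcongr
  · nlinarith
  · nlinarith [Real.pi_gt_three]

/-- With `y = x² / (4 s)` the square equals `s⁻² (4π)⁻¹ y e^{-2y}`. One factor `e^{-y}` absorbs `y`;
the other is kept for integrability in `x`. -/
theorem sq_deriv_heatKernel_le {s : ℝ} (hs : 0 < s) (x : ℝ) :
    (-(x / (2 * s)) * heatKernel s x) ^ 2 ≤ s⁻¹ ^ 2 * Real.exp (-(x ^ 2 / (4 * s))) := by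
  set y := x ^ 2 / (4 * s) with hy
  have hye : y * Real.exp (-y) ≤ 1 := by
    rw [Real.exp_neg, ← div_eq_mul_inv, div_le_one (Real.exp_pos y)]
    linarith [Real.add_one_le_exp y]
  have he0 := Real.exp_pos (-y)
  have hpi : (4 * Real.pi)⁻¹ ≤ 1 := inv_le_one_of_one_le₀ (by linarith [Real.pi_gt_three])
  have hpi0 : 0 ≤ (4 * Real.pi)⁻¹ := by positivity
  have e : (-(x / (2 * s)) * heatKernel s x) ^ 2 =
      s⁻¹ ^ 2 * Real.exp (-y) * ((4 * Real.pi)⁻¹ * (y * Real.exp (-y))) := by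
    rw [heatKernel, mul_pow, div_pow _ (√_), Real.sq_sqrt (by positivity), ← hy, hy]
    field_simp
    ring
  rw [e]
  refine mul_le_of_le_one_right (by positivity) ?_
  exact mul_le_one₀ hpi (by positivity) hye

theorem heatDirac_fst {s : ℝ} (hs : 0 < s) :
    (heatDirac s).1.fst =ᵐ[volume] heatKernel s := by
  simp only [heatDirac, hs, dif_pos]
  refine (MemLp.coeFn_toLp (f := heatConvMeasure s (Measure.dirac 0)) ?_).trans ?_
  · rw [heatConvMeasure_dirac]; exact memLp_heatKernel hs
  · rw [heatConvMeasure_dirac]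

theorem heatDirac_snd {s : ℝ} (hs : 0 < s) :
    (heatDirac s).1.snd =ᵐ[volume] fun x => -(x / (2 * s)) * heatKernel s x := by
  simp only [heatDirac, hs, dif_pos]
  exact MemLp.coeFn_toLp (memLp_deriv_heatKernel hs)

/-- The squared norms of the kernel and of its derivative are at most `4 s^(-1/2)` and `4 s^(-3/2)`.
The exponents are written as `p - 1` with `p > 0`, the form in which they enter the Gamma integral.
-/
theorem norm_heatDirac_le {s : ℝ} (hs : 0 < s) :
    ‖heatDirac s‖ ≤ 2 * (s ^ (3 / 4 - 1 : ℝ) + s ^ (1 / 4 - 1 : ℝ)) := by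
  have hi := integrable_exp_neg_sq_div hs
  have h1 : ‖(heatDirac s).1.fst‖ ^ 2 ≤ s⁻¹ * (4 * √s) := by
    rw [norm_sq_eq_integral (heatDirac_fst hs)]
    refine (integral_mono ((memLp_two_iff_integrable_sq
      (continuous_heatKernel s).aestronglyMeasurable).mp (memLp_heatKernel hs))
      (hi.const_mul s⁻¹) (sq_heatKernel_le hs)).trans ?_
    rw [integral_const_mul]
    gcongr
    exact integral_exp_neg_sq_div_le hs
  have h2 : ‖(heatDirac s).1.snd‖ ^ 2 ≤ s⁻¹ ^ 2 * (4 * √s) := by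
    rw [norm_sq_eq_integral (heatDirac_snd hs)]
    have hm := memLp_deriv_heatKernel hs
    refine (integral_mono ((memLp_two_iff_integrable_sq hm.1).mp hm)
      (hi.const_mul (s⁻¹ ^ 2)) (sq_deriv_heatKernel_le hs)).trans ?_
    rw [integral_const_mul]
    gcongr
    exact integral_exp_neg_sq_div_le hs
  have e1 : s⁻¹ * √s = (s ^ (3 / 4 - 1 : ℝ)) ^ 2 := by
    rw [Real.sqrt_eq_rpow, ← Real.rpow_neg_one, ← Real.rpow_add hs, ← Real.rpow_natCast,
      ← Real.rpow_mul hs.le]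
    norm_num
  have e2 : s⁻¹ ^ 2 * √s = (s ^ (1 / 4 - 1 : ℝ)) ^ 2 := by
    rw [Real.sqrt_eq_rpow, ← Real.rpow_neg_one, ← Real.rpow_natCast, ← Real.rpow_mul hs.le,
      ← Real.rpow_add hs, ← Real.rpow_natCast, ← Real.rpow_mul hs.le]
    norm_num
  have p1 : 0 < s ^ (3 / 4 - 1 : ℝ) := Real.rpow_pos_of_pos hs _
  have p2 : 0 < s ^ (1 / 4 - 1 : ℝ) := Real.rpow_pos_of_pos hs _
  refine le_of_sq_le_sq ?_ (by positivity)
  rw [H1.norm_sq]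
  nlinarith [mul_pos p1 p2]

/-- Dominated convergence for `(F s x - F s₀ x)²`, which is at most `2 F(s, x)² + 2 F(s₀, x)² ≤ 4
b(x)`. -/
theorem continuousAt_of_sq_le {F : ℝ → ℝ → ℝ} {G : ℝ → Lp ℝ 2 (volume : Measure ℝ)} {s₀ : ℝ}
    (hG : ∀ᶠ s in 𝓝 s₀, G s =ᵐ[volume] F s) {b : ℝ → ℝ} (hb : Integrable b)
    (hFb : ∀ᶠ s in 𝓝 s₀, ∀ x, F s x ^ 2 ≤ b x)
    (hc : ∀ x, ContinuousAt (fun s => F s x) s₀) : ContinuousAt G s₀ := by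
  have hG0 := hG.self_of_nhds
  have hFb0 := hFb.self_of_nhds
  have hlim : Tendsto (fun s => ∫ x, (G s - G s₀ : Lp ℝ 2 (volume : Measure ℝ)) x ^ 2) (𝓝 s₀)
      (𝓝 (∫ _ : ℝ, (0 : ℝ))) := by
    have hcongr : ∀ᶠ s in 𝓝 s₀, (G s - G s₀ : Lp ℝ 2 (volume : Measure ℝ)) =ᵐ[volume]
        fun x => F s x - F s₀ x := by
      filter_upwards [hG] with s hs
      filter_upwards [Lp.coeFn_sub (G s) (G s₀), hs, hG0] with x h1 h2 h3
      rw [h1, Pi.sub_apply, h2, h3]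
    have hlim' : Tendsto (fun s => ∫ x, (F s x - F s₀ x) ^ 2) (𝓝 s₀)
        (𝓝 (∫ _ : ℝ, (0 : ℝ))) := by
      refine tendsto_integral_filter_of_dominated_convergence (fun x => 4 * b x) ?_ ?_
        (hb.const_mul 4) (ae_of_all _ fun x => ?_)
      · filter_upwards [hcongr] with s hs
        exact ((Lp.aestronglyMeasurable _).congr hs).pow 2
      · filter_upwards [hFb] with s hs
        refine ae_of_all _ fun x => ?_
        rw [Real.norm_of_nonneg (sq_nonneg _)]
        nlinarith [hs x, hFb0 x, sq_nonneg (F s x + F s₀ x)]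
      · have h := ((hc x).tendsto.sub_const (F s₀ x)).pow 2
        simpa using h
    refine hlim'.congr' ?_
    filter_upwards [hcongr] with s hs
    refine integral_congr_ae ?_
    filter_upwards [hs] with x hx
    rw [hx]
  rw [ContinuousAt, tendsto_iff_norm_sub_tendsto_zero]
  have h2 := hlim.sqrt
  simp only [← norm_sq_eq_integral (EventuallyEq.refl _ _), Real.sqrt_sq (norm_nonneg _),
    integral_zero, Real.sqrt_zero] at h2
  exact h2

theorem continuousOn_heatDirac : ContinuousOn heatDirac (Ioi 0) := by
  -- On `(s₀ / 2, 2 s₀)` the negative powers of `s` and the Gaussian factor are bounded uniformly in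
  -- `s`.
  have hb : ∀ s₀ : ℝ, 0 < s₀ → ∀ᶠ s in 𝓝 s₀, 0 < s ∧ s⁻¹ ≤ 2 / s₀ ∧ s ≤ 2 * s₀ := by
    intro s₀ h0
    filter_upwards [Ioo_mem_nhds (by linarith : s₀ / 2 < s₀) (by linarith : s₀ < 2 * s₀)]
      with s hs
    have hs0 : 0 < s := by linarith [hs.1]
    refine ⟨hs0, ?_, hs.2.le⟩
    rw [inv_eq_one_div, div_le_div_iff₀ hs0 h0]
    linarith [hs.1]
  have hexp : ∀ {s s₀ : ℝ}, 0 < s → s ≤ 2 * s₀ → ∀ x : ℝ,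
      Real.exp (-(x ^ 2 / (4 * s))) ≤ Real.exp (-(x ^ 2 / (4 * (2 * s₀)))) := by
    intro s s₀ h1 h2 x
    gcongr
  have hK : ∀ (s₀ : ℝ), 0 < s₀ → ∀ x, ContinuousAt (fun s => heatKernel s x) s₀ := by
    intro s₀ h0 x
    unfold heatKernel
    have : √(4 * Real.pi * s₀) ≠ 0 := (Real.sqrt_pos.mpr (by positivity)).ne'
    have : 4 * s₀ ≠ 0 := by positivity
    fun_prop (disch := assumption)
  refine H1.continuousOn_iff.mpr ⟨fun s₀ (h0 : 0 < s₀) => ContinuousAt.continuousWithinAt ?_,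
    fun s₀ (h0 : 0 < s₀) => ContinuousAt.continuousWithinAt ?_⟩
  · refine continuousAt_of_sq_le (F := heatKernel)
      (b := fun x => 2 / s₀ * Real.exp (-(x ^ 2 / (4 * (2 * s₀))))) ?_
      ((integrable_exp_neg_sq_div (by positivity)).const_mul _) ?_ (hK s₀ h0)
    · filter_upwards [hb s₀ h0] with s hs using heatDirac_fst hs.1
    · filter_upwards [hb s₀ h0] with s hs x
      refine (sq_heatKernel_le hs.1 x).trans ?_
      have := hexp hs.1 hs.2.2 x
      have := hs.2.1
      gcongr
  · refine continuousAt_of_sq_le (F := fun s x => -(x / (2 * s)) * heatKernel s x)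
      (b := fun x => (2 / s₀) ^ 2 * Real.exp (-(x ^ 2 / (4 * (2 * s₀))))) ?_
      ((integrable_exp_neg_sq_div (by positivity)).const_mul _) ?_ fun x => ?_
    · filter_upwards [hb s₀ h0] with s hs using heatDirac_snd hs.1
    · filter_upwards [hb s₀ h0] with s hs x
      refine (sq_deriv_heatKernel_le hs.1 x).trans ?_
      have := hexp hs.1 hs.2.2 x
      have := hs.2.1
      have := inv_pos.mpr hs.1
      gcongr
    · have : 2 * s₀ ≠ 0 := by positivity
      exact ContinuousAt.mul (by fun_prop (disch := assumption)) (hK s₀ h0 x)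

/-! ### Volterra convolutions with an integrable kernel -/

section Volterra

variable {E : Type*} [NormedAddCommGroup E] [NormedSpace ℝ E]

theorem intervalIntegrable_smul_comp_sub {ψ : ℝ → ℝ} {k : ℝ → E} {t : ℝ} (ht : 0 ≤ t)
    (hψ : MemLp ψ ∞ (volume.restrict (Icc 0 t))) (hk : IntegrableOn k (Ioc 0 t)) :
    IntervalIntegrable (fun τ => ψ τ • k (t - τ)) volume 0 t := by
  have h1 : IntervalIntegrable k volume 0 t :=
    (intervalIntegrable_iff_integrableOn_Ioc_of_le ht).mpr hk
  have h2 := (h1.comp_sub_left t).symm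
  rw [sub_self, sub_zero] at h2
  rw [intervalIntegrable_iff_integrableOn_Ioc_of_le ht] at h2 ⊢
  exact h2.smul_of_top_right (hψ.mono_measure (Measure.restrict_mono Ioc_subset_Icc_self le_rfl))

theorem integral_smul_comp_sub_eq {T t : ℝ} (ht : t ∈ Icc 0 T) (ψ : ℝ → ℝ) (k : ℝ → E) :
    ∫ τ, (Icc 0 T).indicator ψ τ • (Ioc 0 T).indicator k (t - τ) =
      ∫ τ in (0 : ℝ)..t, ψ τ • k (t - τ) := by
  -- The cut-off integrand vanishes at `τ = t`, where the kernel argument is `0`, so the two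
  -- integrands agree on `Ico 0 t` rather than on `Ioc 0 t`; the endpoints are null.
  rw [intervalIntegral.integral_of_le ht.1, ← integral_Icc_eq_integral_Ioc,
    integral_Icc_eq_integral_Ico, ← integral_indicator measurableSet_Ico]
  congr 1
  ext τ
  by_cases hτ : τ ∈ Ico 0 t
  · rw [indicator_of_mem hτ, indicator_of_mem, indicator_of_mem]
    · exact ⟨by linarith [hτ.2], by linarith [hτ.1, ht.2]⟩
    · exact ⟨hτ.1, by linarith [hτ.2, ht.2]⟩
  · rw [indicator_of_notMem hτ]
    by_cases h0 : 0 ≤ τ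
    · rw [indicator_of_notMem (s := Ioc 0 T), smul_zero]
      exact fun h => hτ ⟨h0, by linarith [h.1]⟩
    · rw [indicator_of_notMem (s := Icc 0 T), zero_smul]
      exact fun h => h0 h.1

/-- The integral is the `L^∞`–`L¹` pairing of `ψ` with a translate of the reflected kernel, and
translation is continuous in `L¹`. Hence `ψ` need not be continuous, which matters for `Φ`. -/
theorem continuousOn_integral_smul_comp_sub [CompleteSpace E] {T : ℝ} {ψ : ℝ → ℝ} {k : ℝ → E}
    (hψ : MemLp ψ ∞ (volume.restrict (Icc 0 T))) (hk : IntegrableOn k (Ioc 0 T)) :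
    ContinuousOn (fun t => ∫ τ in (0 : ℝ)..t, ψ τ • k (t - τ)) (Icc 0 T) := by
  have hΨ : MemLp ((Icc 0 T).indicator ψ) ∞ volume :=
    (memLp_indicator_iff_restrict measurableSet_Icc).mpr hψ
  have hK : MemLp (fun x => (Ioc 0 T).indicator k (-x)) 1 volume :=
    memLp_one_iff_integrable.mpr (hk.integrable_indicator measurableSet_Ioc).comp_neg
  have hne : Fact ((1 : ℝ≥0∞) ≠ ⊤) := ⟨by norm_num⟩
  have hc : Continuous fun t : ℝ => DomAddAct.mk (-t) +ᵥ hK.toLp _ :=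
    continuous_translate continuous_neg _
  have hc2 : Continuous fun t : ℝ => ContinuousLinearMap.lpPairing volume ∞ 1
      (ContinuousLinearMap.lsmul ℝ ℝ : ℝ →L[ℝ] E →L[ℝ] E) (hΨ.toLp _)
      (DomAddAct.mk (-t) +ᵥ hK.toLp _) :=
    (ContinuousLinearMap.continuous _).comp hc
  refine hc2.continuousOn.congr fun t ht => ?_
  simp only
  rw [← integral_smul_comp_sub_eq ht, ContinuousLinearMap.lpPairing_eq_integral]
  refine integral_congr_ae ?_
  filter_upwards [hΨ.coeFn_toLp, DomAddAct.vadd_Lp_ae_eq (DomAddAct.mk (-t)) (hK.toLp _),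
    (measurePreserving_vadd (-t) (volume : Measure ℝ)).quasiMeasurePreserving.ae
      hK.coeFn_toLp] with τ h1 h2 h3
  rw [h1, h2, Equiv.symm_apply_apply, h3]
  simp [sub_eq_neg_add]

/-- Writing `e^{rτ} = e^{rt} e^{-r(t-τ)}` moves the growth of `ψ` onto the kernel as a decaying
weight. -/
theorem norm_integral_smul_comp_sub_le {ψ : ℝ → ℝ} {k : ℝ → E} {r A t : ℝ} (ht : 0 ≤ t)
    (hψ : ∀ τ ∈ Icc 0 t, |ψ τ| ≤ A * Real.exp (r * τ))
    (hk : IntegrableOn (fun s => Real.exp (-(r * s)) * ‖k s‖) (Ioi 0)) :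
    ‖∫ τ in (0 : ℝ)..t, ψ τ • k (t - τ)‖ ≤
      A * Real.exp (r * t) * ∫ s in Ioi 0, Real.exp (-(r * s)) * ‖k s‖ := by
  have hA : 0 ≤ A := by
    have h := (abs_nonneg _).trans (hψ 0 ⟨le_rfl, ht⟩)
    simpa using h
  have hi : IntervalIntegrable (fun s => Real.exp (-(r * s)) * ‖k s‖) volume 0 t :=
    (intervalIntegrable_iff_integrableOn_Ioc_of_le ht).mpr
      (hk.mono_set Ioc_subset_Ioi_self)
  have hi2 := (hi.comp_sub_left t).symm
  rw [sub_self, sub_zero] at hi2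
  have h1 := intervalIntegral.norm_integral_le_of_norm_le (μ := volume) ht
    (f := fun τ => ψ τ • k (t - τ))
    (g := fun τ => A * Real.exp (r * t) * (Real.exp (-(r * (t - τ))) * ‖k (t - τ)‖))
    (ae_of_all _ fun τ hτ => ?_) (hi2.const_mul _)
  · refine h1.trans ?_
    rw [intervalIntegral.integral_const_mul,
      intervalIntegral.integral_comp_sub_left (fun s => Real.exp (-(r * s)) * ‖k s‖) t,
      sub_self, sub_zero, intervalIntegral.integral_of_le ht]
    exact mul_le_mul_of_nonneg_left (setIntegral_mono_set hk
      (ae_of_all _ fun s => by simp only [Pi.zero_apply]; positivity)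
      Ioc_subset_Ioi_self.eventuallyLE) (by positivity)
  · rw [norm_smul, Real.norm_eq_abs]
    have e : A * Real.exp (r * t) * (Real.exp (-(r * (t - τ))) * ‖k (t - τ)‖) =
        A * Real.exp (r * τ) * ‖k (t - τ)‖ := by
      have : Real.exp (r * τ) = Real.exp (r * t) * Real.exp (-(r * (t - τ))) := by
        rw [← Real.exp_add]; congr 1; ring
      rw [this]; ring
    rw [e]
    gcongr
    exact hψ τ ⟨hτ.1.le, hτ.2⟩

/-- A kernel on `(0, ∞)` whose exponentially weighted integral can be made arbitrarily small. -/
structure IsVolterraKernel (k : ℝ → E) : Prop where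
  integrableOn : ∀ T, IntegrableOn k (Ioc 0 T)
  exists_weight : ∀ ε > 0, ∃ r ≥ 0,
    IntegrableOn (fun s => Real.exp (-(r * s)) * ‖k s‖) (Ioi 0) ∧
      ∫ s in Ioi 0, Real.exp (-(r * s)) * ‖k s‖ ≤ ε

/-- The Volterra convolution `t ↦ ∫₀ᵗ ψ(τ) k(t - τ) dτ` as a continuous function. -/
def volterraConv [CompleteSpace E] {k : ℝ → E} (hk : IsVolterraKernel k) {ψ : ℝ → ℝ}
    (hψ : ∀ T : ℝ, MemLp ψ ∞ (volume.restrict (Icc 0 T))) : C(ℝ≥0, E) where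
  toFun t := ∫ τ in (0 : ℝ)..t, ψ τ • k (t - τ)
  continuous_toFun := by
    refine continuous_iff_continuousAt.mpr fun t => ?_
    have h := (continuousOn_integral_smul_comp_sub (hψ (t + 1)) (hk.integrableOn _))
    have hc : ContinuousWithinAt (fun s : ℝ≥0 => ∫ τ in (0 : ℝ)..s, ψ τ • k (s - τ))
        (Iic (t + 1)) t :=
      (h t ⟨t.2, by simp⟩).comp NNReal.continuous_coe.continuousWithinAt
        fun s (hs : s ≤ t + 1) => ⟨s.2, by exact_mod_cast hs⟩
    exact hc.continuousAt (Iic_mem_nhds (by simp))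

theorem memLp_top_comp_toNNReal (L : E →L[ℝ] ℝ) (u : C(ℝ≥0, E)) (T : ℝ) :
    MemLp (fun τ => L (u τ.toNNReal)) ∞ (volume.restrict (Icc 0 T)) := by
  have hc : Continuous fun τ : ℝ => L (u τ.toNNReal) := by fun_prop
  obtain ⟨C, hC⟩ := isCompact_Icc.exists_bound_of_continuousOn (s := Icc 0 T) hc.continuousOn
  exact memLp_top_of_bound hc.aestronglyMeasurable C
    ((ae_restrict_iff' measurableSet_Icc).mpr (ae_of_all _ hC))

theorem volterraConv_apply [CompleteSpace E] {k : ℝ → E} (hk : IsVolterraKernel k) {ψ : ℝ → ℝ}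
    (hψ : ∀ T : ℝ, MemLp ψ ∞ (volume.restrict (Icc 0 T))) (t : ℝ≥0) :
    volterraConv hk hψ t = ∫ τ in (0 : ℝ)..t, ψ τ • k (t - τ) := rfl

/-- The linear Volterra operator `u ↦ (t ↦ ∫₀ᵗ L(u(τ)) k(t - τ) dτ)`. -/
def volterra [CompleteSpace E] {k : ℝ → E} (hk : IsVolterraKernel k) (L : E →L[ℝ] ℝ) :
    C(ℝ≥0, E) →ₗ[ℝ] C(ℝ≥0, E) where
  toFun u := volterraConv hk (memLp_top_comp_toNNReal L u)
  map_add' u v := by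
    ext t
    simp only [volterraConv_apply, ContinuousMap.add_apply, map_add, add_smul]
    exact intervalIntegral.integral_add
      (intervalIntegrable_smul_comp_sub t.2 (memLp_top_comp_toNNReal L u t) (hk.integrableOn _))
      (intervalIntegrable_smul_comp_sub t.2 (memLp_top_comp_toNNReal L v t) (hk.integrableOn _))
  map_smul' c u := by
    ext t
    simp only [volterraConv_apply, ContinuousMap.smul_apply, map_smul, smul_assoc,
      RingHom.id_apply]
    exact intervalIntegral.integral_smul c _

variable [CompleteSpace E] {k : ℝ → E} (hk : IsVolterraKernel k) (L : E →L[ℝ] ℝ)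

theorem volterra_apply (u : C(ℝ≥0, E)) (t : ℝ≥0) :
    volterra hk L u t = ∫ τ in (0 : ℝ)..t, L (u τ.toNNReal) • k (t - τ) := rfl


/-- In a suitable exponentially weighted norm, the Volterra operator is a contraction. -/
theorem exists_norm_volterra_le : ∃ r ≥ 0, ∀ (u : C(ℝ≥0, E)) (A : ℝ) (T : ℝ≥0),
    (∀ t ≤ T, ‖u t‖ ≤ A * Real.exp (r * t)) →
      ∀ t ≤ T, ‖volterra hk L u t‖ ≤ A / 2 * Real.exp (r * t) := by
  -- This choice makes `‖L‖` times the weighted integral at most `1 / 2`; the `+ 1` covers `L = 0`.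
  obtain ⟨r, hr, hi, hle⟩ := hk.exists_weight (1 / (2 * (‖L‖ + 1))) (by positivity)
  refine ⟨r, hr, fun u A T hu t ht => ?_⟩
  have hA : 0 ≤ A := by
    have h := (norm_nonneg _).trans (hu 0 (zero_le))
    simpa using h
  have h := norm_integral_smul_comp_sub_le (ψ := fun τ => L (u τ.toNNReal)) (A := ‖L‖ * A)
    t.2 (fun τ hτ => ?_) hi
  · rw [volterra_apply]
    refine h.trans ?_
    calc ‖L‖ * A * Real.exp (r * t) * _
        ≤ (‖L‖ + 1) * A * Real.exp (r * t) * (1 / (2 * (‖L‖ + 1))) := by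
          gcongr
          linarith
      _ = A / 2 * Real.exp (r * t) := by field_simp
  · rw [← Real.norm_eq_abs, mul_assoc]
    refine (L.le_opNorm _).trans ?_
    have h := hu τ.toNNReal ((Real.toNNReal_le_toNNReal hτ.2).trans (by simpa using ht))
    rw [Real.coe_toNNReal _ hτ.1] at h
    gcongr

/-- By linearity continuity at `0` suffices: a bound `ε e^{-rT}` on `[0, T]` is also a weighted
bound, and the image stays below `ε / 2` there. Continuity lets the operator pass through the
Neumann series. -/
theorem continuous_volterra : Continuous (volterra hk L) := by
  refine continuous_of_continuousAt_zero (volterra hk L) ?_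
  obtain ⟨r, hr, hV⟩ := exists_norm_volterra_le hk L
  rw [ContinuousAt, map_zero, ContinuousMap.tendsto_iff_forall_isCompact_tendstoUniformlyOn]
  intro K hK
  obtain ⟨T, hT⟩ := hK.bddAbove
  rw [Metric.tendstoUniformlyOn_iff]
  intro ε hε
  have h := ContinuousMap.tendsto_iff_forall_isCompact_tendstoUniformlyOn.mp
    (tendsto_id (x := 𝓝 (0 : C(ℝ≥0, E)))) (Iic T) (by
      rw [← Icc_bot]; exact isCompact_Icc)
  rw [Metric.tendstoUniformlyOn_iff] at h
  filter_upwards [h (ε / Real.exp (r * T)) (by positivity)] with u hu t ht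
  have htT := hT ht
  simp only [id, ContinuousMap.zero_apply, dist_zero_left] at hu ⊢
  refine (hV u (ε / Real.exp (r * T)) T (fun s hs => ?_) t htT).trans_lt ?_
  · refine (hu s hs).le.trans (le_mul_of_one_le_right (by positivity) ?_)
    exact Real.one_le_exp (by positivity)
  · have : Real.exp (r * t) ≤ Real.exp (r * T) := by gcongr
    calc ε / Real.exp (r * T) / 2 * Real.exp (r * t)
        ≤ ε / Real.exp (r * T) / 2 * Real.exp (r * T) := by gcongr
      _ = ε / 2 := by field_simp
      _ < ε := by linarith

theorem exists_volterra_solution (G : C(ℝ≥0, E)) : ∃ u, u = G + volterra hk L u := by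
  obtain ⟨r, hr, hV⟩ := exists_norm_volterra_le hk L
  let W : C(ℝ≥0, E) →L[ℝ] C(ℝ≥0, E) := ⟨volterra hk L, continuous_volterra hk L⟩
  have hsum : Summable fun n : ℕ => (W ^ n) G := by
    refine ContinuousMap.summable_of_locally_summable_norm fun K => ?_
    obtain ⟨T, hT⟩ := K.isCompact.bddAbove
    obtain ⟨A, hA⟩ := (isCompact_Icc (a := (0 : ℝ≥0)) (b := T)).exists_bound_of_continuousOn
      G.continuous.continuousOn
    have hA0 : 0 ≤ A := (norm_nonneg _).trans (hA 0 ⟨le_rfl, zero_le⟩)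
    have hn : ∀ n : ℕ, ∀ t ≤ T, ‖(W ^ n) G t‖ ≤ A * (1 / 2) ^ n * Real.exp (r * t) := by
      intro n
      induction n with
      | zero =>
        intro t ht
        simp only [pow_zero, one_apply_eq_self, mul_one]
        exact (hA t ⟨zero_le, ht⟩).trans
          (le_mul_of_one_le_right hA0 (Real.one_le_exp (by positivity)))
      | succ n ih =>
        intro t ht
        rw [pow_succ', mul_apply_eq_comp]
        refine (hV _ _ T ih t ht).trans_eq ?_
        ring
    refine Summable.of_nonneg_of_le (fun n => norm_nonneg _) (fun n => ?_)
      ((summable_geometric_of_lt_one (r := 1 / 2) (by norm_num) (by norm_num)).mul_left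
        (A * Real.exp (r * T)))
    rw [ContinuousMap.norm_le _ (by positivity)]
    rintro ⟨t, ht⟩
    have htT : t ≤ T := hT ht
    refine (hn n t htT).trans ?_
    have : Real.exp (r * t) ≤ Real.exp (r * T) := by gcongr
    calc A * (1 / 2) ^ n * Real.exp (r * t) ≤ A * (1 / 2) ^ n * Real.exp (r * T) := by gcongr
      _ = A * Real.exp (r * T) * (1 / 2) ^ n := by ring
  refine ⟨∑' n, (W ^ n) G, ?_⟩
  have e : volterra hk L (∑' n, (W ^ n) G) = ∑' n, (W ^ (n + 1)) G := by
    change W _ = _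
    rw [W.map_tsum hsum]
    simp only [pow_succ', mul_apply_eq_comp]
  rw [e]
  exact hsum.tsum_eq_zero_add

/-- Any bound `A` of `u` on `[0, T]` improves itself: inserting `(2B + A 2⁻ⁿ) e^{rt}` into the
equation yields `B + (B + A 2⁻ⁿ⁻¹) e^{rt}`. In the limit `A` disappears, and `r` never depended on
`T`. -/
theorem exists_norm_volterra_solution_le : ∃ r : ℝ, ∀ (u G : C(ℝ≥0, E)) (B : ℝ),
    u = G + volterra hk L u → (∀ t, ‖G t‖ ≤ B) → ∀ t : ℝ≥0, ‖u t‖ ≤ 2 * B * Real.exp (r * t) := by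
  obtain ⟨r, hr, hV⟩ := exists_norm_volterra_le hk L
  refine ⟨r, fun u G B hu hB T => ?_⟩
  have hB0 : 0 ≤ B := (norm_nonneg _).trans (hB 0)
  obtain ⟨A, hA⟩ := (isCompact_Icc (a := (0 : ℝ≥0)) (b := T)).exists_bound_of_continuousOn
    u.continuous.continuousOn
  have hA0 : 0 ≤ A := (norm_nonneg _).trans (hA 0 ⟨le_rfl, zero_le⟩)
  have hexp : ∀ t : ℝ≥0, 1 ≤ Real.exp (r * t) := fun t => Real.one_le_exp (by positivity)
  have hn : ∀ n : ℕ, ∀ t ≤ T, ‖u t‖ ≤ (2 * B + A * (1 / 2) ^ n) * Real.exp (r * t) := by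
    intro n
    induction n with
    | zero =>
      intro t ht
      refine (hA t ⟨zero_le, ht⟩).trans ?_
      nlinarith [hexp t]
    | succ n ih =>
      intro t ht
      have h1 := hV u _ T ih t ht
      have h2 : u t = G t + volterra hk L u t := by
        conv_lhs => rw [hu]
        rfl
      rw [h2]
      refine (norm_add_le _ _).trans ((add_le_add (hB t) h1).trans ?_)
      have h3 : B ≤ B * Real.exp (r * t) := le_mul_of_one_le_right hB0 (hexp t)
      rw [pow_succ]
      linarith
  have hlim : Tendsto (fun n : ℕ => (2 * B + A * (1 / 2) ^ n) * Real.exp (r * T)) atTop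
      (𝓝 ((2 * B + A * 0) * Real.exp (r * T))) :=
    ((tendsto_pow_atTop_nhds_zero_of_lt_one (by norm_num) (by norm_num)).const_mul A
      |>.const_add (2 * B)).mul_const _
  rw [mul_zero, add_zero] at hlim
  exact ge_of_tendsto' hlim fun n => hn n T le_rfl

end Volterra

/-! ### The heat kernel as a Volterra kernel -/

theorem integrableOn_rpow_mul_exp_neg {p r : ℝ} (hp : 0 < p) (hr : 0 < r) :
    IntegrableOn (fun s : ℝ => s ^ (p - 1) * Real.exp (-(r * s))) (Ioi 0) := by
  -- A non-integrable function has Bochner integral `0`, whereas this integral is a positive Gamma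
  -- value.
  refine not_imp_comm.mp integral_undef ?_
  rw [Real.integral_rpow_mul_exp_neg_mul_Ioi hp hr]
  have := Real.Gamma_pos_of_pos hp
  positivity

/-- The norm bound and the Gamma integral give `c₁ Γ(3/4) r^(-3/4) + c₂ Γ(1/4) r^(-1/4)`, which
tends to `0` as `r → ∞`. -/
theorem exists_weight_heatDirac {D : ℝ} (hD : 0 < D) {ε : ℝ} (hε : 0 < ε) : ∃ r ≥ 0,
    IntegrableOn (fun s => Real.exp (-(r * s)) * ‖heatDirac (D * s)‖) (Ioi 0) ∧
      ∫ s in Ioi 0, Real.exp (-(r * s)) * ‖heatDirac (D * s)‖ ≤ ε := by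
  set c₁ : ℝ := 2 * D ^ (3 / 4 - 1 : ℝ)
  set c₂ : ℝ := 2 * D ^ (1 / 4 - 1 : ℝ)
  have hlim : Tendsto (fun r : ℝ => c₁ * ((1 / r) ^ (3 / 4 : ℝ) * Real.Gamma (3 / 4)) +
      c₂ * ((1 / r) ^ (1 / 4 : ℝ) * Real.Gamma (1 / 4))) atTop (𝓝 0) := by
    have h : ∀ p : ℝ, 0 < p → Tendsto (fun r : ℝ => (1 / r) ^ p) atTop (𝓝 0) := fun p hp => by
      have h1 : Tendsto (fun r : ℝ => 1 / r) atTop (𝓝 0) := by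
        simpa using tendsto_inv_atTop_zero (𝕜 := ℝ)
      have h2 := h1.rpow_const (p := p) (Or.inr hp.le)
      rwa [Real.zero_rpow hp.ne'] at h2
    have h3 := (((h (3 / 4) (by norm_num)).mul_const (Real.Gamma (3 / 4))).const_mul c₁).add
      (((h (1 / 4) (by norm_num)).mul_const (Real.Gamma (1 / 4))).const_mul c₂)
    simpa using h3
  obtain ⟨r, hrε, hr⟩ := ((hlim.eventually_le_const hε).and (eventually_gt_atTop 0)).exists
  have i1 := (integrableOn_rpow_mul_exp_neg (p := 3 / 4) (by norm_num) hr).const_mul c₁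
  have i2 := (integrableOn_rpow_mul_exp_neg (p := 1 / 4) (by norm_num) hr).const_mul c₂
  have hle : ∀ s ∈ Ioi (0 : ℝ), Real.exp (-(r * s)) * ‖heatDirac (D * s)‖ ≤
      c₁ * (s ^ (3 / 4 - 1 : ℝ) * Real.exp (-(r * s))) +
        c₂ * (s ^ (1 / 4 - 1 : ℝ) * Real.exp (-(r * s))) := by
    intro s (hs : 0 < s)
    have h := norm_heatDirac_le (mul_pos hD hs)
    rw [Real.mul_rpow hD.le hs.le, Real.mul_rpow hD.le hs.le] at h
    refine (mul_le_mul_of_nonneg_left h (Real.exp_pos _).le).trans_eq ?_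
    ring
  have hm : ContinuousOn (fun s => Real.exp (-(r * s)) * ‖heatDirac (D * s)‖) (Ioi 0) := by
    refine ContinuousOn.mul (by fun_prop) (ContinuousOn.norm ?_)
    exact continuousOn_heatDirac.comp (by fun_prop) fun s (hs : 0 < s) => mul_pos hD hs
  have hi : IntegrableOn (fun s => Real.exp (-(r * s)) * ‖heatDirac (D * s)‖) (Ioi 0) := by
    refine (i1.add i2).mono' (hm.aestronglyMeasurable measurableSet_Ioi)
      ((ae_restrict_iff' measurableSet_Ioi).mpr (ae_of_all _ fun s hs => ?_))
    rw [Real.norm_of_nonneg (by positivity)]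
    exact hle s hs
  refine ⟨r, hr.le, hi, ?_⟩
  refine (setIntegral_mono_on hi (i1.add i2) measurableSet_Ioi hle).trans ?_
  rw [integral_add' i1 i2, integral_const_mul, integral_const_mul,
    Real.integral_rpow_mul_exp_neg_mul_Ioi (by norm_num) hr,
    Real.integral_rpow_mul_exp_neg_mul_Ioi (by norm_num) hr]
  exact hrε

theorem isVolterraKernel_heatDirac {D : ℝ} (hD : 0 < D) :
    IsVolterraKernel fun s => heatDirac (D * s) where
  exists_weight _ hε := exists_weight_heatDirac hD hε
  integrableOn T := by
    obtain ⟨r, hr, hi, -⟩ := exists_weight_heatDirac hD one_pos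
    have hm : ContinuousOn (fun s => heatDirac (D * s)) (Ioi 0) :=
      continuousOn_heatDirac.comp (by fun_prop) fun s (hs : 0 < s) => mul_pos hD hs
    refine ((hi.mono_set Ioc_subset_Ioi_self).const_mul (Real.exp (r * T))).mono'
      ((hm.mono Ioc_subset_Ioi_self).aestronglyMeasurable measurableSet_Ioc)
      ((ae_restrict_iff' measurableSet_Ioc).mpr (ae_of_all _ fun s hs => ?_))
    rw [← mul_assoc, ← Real.exp_add]
    refine le_mul_of_one_le_left (norm_nonneg _) (Real.one_le_exp ?_)
    nlinarith [hs.2]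

/-! ### Mild solutions as solutions of a linear Volterra equation -/

/-- The orbit `t ↦ e^{tDΔ} u₀` of the diffusion semigroup. -/
def heatOrbit {D : ℝ} (hD : 0 < D) (u₀ : H1) : C(ℝ≥0, H1) where
  toFun t := heatSemigroup (D * t) u₀
  continuous_toFun := (continuousOn_heatSemigroup u₀).comp_continuous (by fun_prop)
    fun t => mul_nonneg hD.le t.2

theorem norm_heatOrbit_sub_le {D : ℝ} (hD : 0 < D) (u₀ v₀ : H1) (t : ℝ≥0) :
    ‖(heatOrbit hD u₀ - heatOrbit hD v₀) t‖ ≤ ‖u₀ - v₀‖ := by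
  have ht : 0 ≤ D * t := mul_nonneg hD.le t.2
  change ‖heatSemigroup (D * t) u₀ - heatSemigroup (D * t) v₀‖ ≤ _
  rw [← heatSemigroup_sub ht]
  exact norm_heatSemigroup_le ht _

theorem MemLinftyLoc.memLp_Icc {Φ : ℝ → ℝ} (hΦ : MemLinftyLoc Φ) (T : ℝ) :
    MemLp Φ ∞ (volume.restrict (Icc 0 T)) :=
  hΦ _ isCompact_Icc Icc_subset_Ici_self

/-- The linear feedback `f ↦ -a (f(-R) + f(R))`. -/
def feedback (R a : ℝ) : H1 →L[ℝ] ℝ := (-a) • (H1.evalL (-R) + H1.evalL R)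

theorem sourceIntensity_eq (R a : ℝ) (Φ : ℝ → ℝ) (u : ℝ≥0 → H1) (τ : ℝ) :
    sourceIntensity R a Φ u τ = Φ τ + feedback R a (u τ.toNNReal) := by
  simp [sourceIntensity, feedback, H1.evalL_apply]
  ring

/-- For continuous `u` both parts of the source are bounded on `[0, t]` and the kernel is
integrable, so the integrability clause holds automatically and the integral splits. -/
theorem isMildSolution_iff {D : ℝ} (hD : 0 < D) (R a : ℝ) {Φ : ℝ → ℝ} (hΦ : MemLinftyLoc Φ)
    (u₀ : H1) (u : C(ℝ≥0, H1)) :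
    IsMildSolution D R a Φ u₀ u ↔
      u = heatOrbit hD u₀ + volterraConv (isVolterraKernel_heatDirac hD) hΦ.memLp_Icc +
        volterra (isVolterraKernel_heatDirac hD) (feedback R a) u := by
  have hk := isVolterraKernel_heatDirac hD
  have i1 : ∀ t : ℝ≥0, IntervalIntegrable (fun τ => Φ τ • heatDirac (D * (t - τ))) volume 0 t :=
    fun t => intervalIntegrable_smul_comp_sub (k := fun s => heatDirac (D * s)) t.2
      (hΦ.memLp_Icc t) (hk.integrableOn t)
  have i2 : ∀ t : ℝ≥0, IntervalIntegrable
      (fun τ => feedback R a (u τ.toNNReal) • heatDirac (D * (t - τ))) volume 0 t :=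
    fun t => intervalIntegrable_smul_comp_sub (k := fun s => heatDirac (D * s)) t.2
      (memLp_top_comp_toNNReal (feedback R a) u t) (hk.integrableOn t)
  have e : ∀ t : ℝ≥0, heatSemigroup (D * t) u₀ +
      ∫ τ in (0 : ℝ)..t, sourceIntensity R a Φ u τ • heatDirac (D * (t - τ)) =
      (heatOrbit hD u₀ + volterraConv hk hΦ.memLp_Icc + volterra hk (feedback R a) u) t := by
    intro t
    simp only [sourceIntensity_eq, add_smul]
    rw [intervalIntegral.integral_add (i1 t) (i2 t), ← add_assoc]
    rfl
  refine ⟨fun h => ?_, fun h => ⟨fun t => ?_, fun t => ?_⟩⟩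
  · ext1 t
    rw [← e t]
    exact h.formula t
  · simp only [sourceIntensity_eq, add_smul]
    exact (i1 t).add (i2 t)
  · rw [e t]
    exact congrArg (fun v : C(ℝ≥0, H1) => v t) h

/-- In the difference of two solutions the `Φ` term cancels; what drives it is the heat orbit of `u₀
- v₀`, bounded by contractivity. -/
theorem exists_norm_isMildSolution_sub_le {D : ℝ} (hD : 0 < D) (R a : ℝ) {Φ : ℝ → ℝ}
    (hΦ : MemLinftyLoc Φ) : ∃ r : ℝ, ∀ (u₀ v₀ : H1) (u v : C(ℝ≥0, H1)),
      IsMildSolution D R a Φ u₀ u → IsMildSolution D R a Φ v₀ v →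
        ∀ t : ℝ≥0, ‖u t - v t‖ ≤ 2 * ‖u₀ - v₀‖ * Real.exp (r * t) := by
  obtain ⟨r, hr⟩ := exists_norm_volterra_solution_le (isVolterraKernel_heatDirac hD)
    (feedback R a)
  refine ⟨r, fun u₀ v₀ u v hu hv => ?_⟩
  rw [isMildSolution_iff hD R a hΦ] at hu hv
  refine hr (u - v) (heatOrbit hD u₀ - heatOrbit hD v₀) _ ?_ (norm_heatOrbit_sub_le hD u₀ v₀)
  rw [map_sub]
  conv_lhs => rw [hu, hv]
  abel

theorem continuous_solutionMap {D : ℝ} (hD : 0 < D) (R a : ℝ) {Φ : ℝ → ℝ}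
    (hΦ : MemLinftyLoc Φ) (S : H1 → C(ℝ≥0, H1))
    (hS : ∀ u₀, IsMildSolution D R a Φ u₀ (S u₀)) : Continuous S := by
  obtain ⟨r, hr⟩ := exists_norm_isMildSolution_sub_le hD R a hΦ
  refine continuous_iff_continuousAt.mpr fun u₀ => ?_
  rw [ContinuousAt, ContinuousMap.tendsto_iff_forall_isCompact_tendstoUniformlyOn]
  intro K hK
  obtain ⟨C, hC⟩ := hK.exists_bound_of_continuousOn
    (f := fun t : ℝ≥0 => Real.exp (r * t)) (by fun_prop)
  rw [Metric.tendstoUniformlyOn_iff]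
  intro ε hε
  have hlim : Tendsto (fun v₀ => 2 * ‖u₀ - v₀‖ * C) (𝓝 u₀) (𝓝 (2 * ‖u₀ - u₀‖ * C)) := by
    have : Continuous fun v₀ : H1 => 2 * ‖u₀ - v₀‖ * C := by fun_prop
    exact this.continuousAt
  rw [sub_self, norm_zero, mul_zero, zero_mul] at hlim
  filter_upwards [hlim.eventually_lt_const hε] with v₀ hv t ht
  rw [dist_eq_norm]
  refine (hr u₀ v₀ _ _ (hS u₀) (hS v₀) t).trans_lt (lt_of_le_of_lt ?_ hv)
  gcongr
  exact (le_abs_self _).trans (hC t ht)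

theorem existsUnique_isMildSolution {D : ℝ} (hD : 0 < D) (R a : ℝ) {Φ : ℝ → ℝ}
    (hΦ : MemLinftyLoc Φ) (u₀ : H1) : ∃! u : C(ℝ≥0, H1), IsMildSolution D R a Φ u₀ u := by
  obtain ⟨u, hu⟩ := exists_volterra_solution (isVolterraKernel_heatDirac hD) (feedback R a)
    (heatOrbit hD u₀ + volterraConv (isVolterraKernel_heatDirac hD) hΦ.memLp_Icc)
  have hu' := (isMildSolution_iff hD R a hΦ u₀ u).mpr hu
  refine ⟨u, hu', fun v hv => ?_⟩
  obtain ⟨r, hr⟩ := exists_norm_isMildSolution_sub_le hD R a hΦ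
  ext1 t
  have h := hr u₀ u₀ v u hv hu' t
  rw [sub_self, norm_zero, mul_zero, zero_mul] at h
  exact sub_eq_zero.mp (norm_le_zero_iff.mp h)

end DiracSource

end

theorem theorem2p1 (D R a : ℝ) (hD : 0 < D) (hR : 0 < R)
    (Φ : ℝ → ℝ) (hΦ : DiracSource.MemLinftyLoc Φ) :
    (∀ u₀ : DiracSource.H1, ∃! u : C(ℝ≥0, DiracSource.H1),
      DiracSource.IsMildSolution D R a Φ u₀ u) ∧
    -- `C(ℝ≥0, H1)` carries the topology of uniform convergence on compact subsets of `[0, ∞)`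
    (∀ S : DiracSource.H1 → C(ℝ≥0, DiracSource.H1),
      (∀ u₀ : DiracSource.H1, DiracSource.IsMildSolution D R a Φ u₀ (S u₀)) →
        Continuous S) :=
  ⟨DiracSource.existsUnique_isMildSolution hD R a hΦ,
    DiracSource.continuous_solutionMap hD R a hΦ⟩
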